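/- Let $a>0$ and let $V\in L^\infty((-a/2,a/2))$ be real-valued, with Fourier coefficients $$a_j=\frac2a\int_{-a/2}^{a/2}V(x)\sin\frac{2\pi j}{a}x\,dx,\qquad b_j=\frac2a\int_{-a/2}^{a/2}V(x)\cos\frac{2\pi j}{a}x\,dx\quad(j\ge 1),\qquad b_0=\frac1a\int_{-a/2}^{a/2}V(x)\,dx,$$ so that $V(x)=\sum_{j\ge1}a_j\sin\frac{2\pi j}{a}x+\sum_{j\ge0}b_j\cos\frac{2\pi j}{a}x$ in $L^2((-a/2,a/2))$. The operators $-\frac{d^2}{dx^2}+V$ in $L^2((-a/2,a/2))$ with domain $\{u\in H^2((-a/2,a/2)) : u(a/2)=\sigma u(-a/2),\ u'(a/2)=\sigma u'(-a/2)\}$, where $\sigma=1$ (periodic boundary conditions) or $\sigma=-1$ (antiperiodic boundary conditions), have real eigenvalues of finite multiplicity that can be enumerated in non-decreasing order, counted with multiplicity; let $\kappa_1\le\kappa_2\le\cdots$ be those for $\sigma=1$ and $\nu_1\le\nu_2\le\cdots$ those for $\sigma=-1$. Let $n\ge1$ be an integer such that $$0<\sqrt{a_n^2+b_n^2}<\frac{12\pi^2}{a^2}n^2$$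 and $$\left\Vert V(x)-b_0-a_n\sin\frac{2\pi n}{a}x-b_n\cos\frac{2\pi n}{a}x\right\Vert_{L^\infty((-a/2,a/2))}<\frac14\sqrt{a_n^2+b_n^2}.$$ Then $$\nu_{n+1}-\nu_n>0\ \text{ if } n \text{ is odd},\qquad \kappa_{n+1}-\kappa_n>0\ \text{ if } n \text{ is even}.$$ -/

import Mathlib

open MeasureTheory Set

noncomputable section

namespace Hill

/-- Lebesgue measure on the open interval `(-a/2, a/2)`. -/
abbrev cellMeasure (a : ℝ) : Measure ℝ := volume.restrict (Ioo (-a / 2) (a / 2))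

/-- The complex Hilbert space `L²((-a/2, a/2))`. -/
abbrev L2 (a : ℝ) : Type := Lp ℂ 2 (cellMeasure a)

/-- Sine Fourier coefficient of `V` on `(-a/2, a/2)`. -/
def sinCoeff (a : ℝ) (V : ℝ → ℝ) (j : ℕ) : ℝ :=
  2 / a * ∫ x in (-a / 2)..(a / 2), V x * Real.sin (2 * Real.pi * j / a * x)

/-- Cosine Fourier coefficient of `V` on `(-a/2, a/2)`; for `j = 0` it is the mean value of `V`, so
that `V = ∑_{j ≥ 1} a_j sin (2πjx/a) + ∑_{j ≥ 0} b_j cos (2πjx/a)` in `L²`. -/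
def cosCoeff (a : ℝ) (V : ℝ → ℝ) (j : ℕ) : ℝ :=
  if j = 0 then 1 / a * ∫ x in (-a / 2)..(a / 2), V x
  else 2 / a * ∫ x in (-a / 2)..(a / 2), V x * Real.cos (2 * Real.pi * j / a * x)

/-- `u` belongs to `H²((-a/2, a/2))` with `u' = v` and `u'' = w`: on the closed interval `u` and `v`
are the absolutely continuous representatives of a function and of its derivative, and the
second derivative `w` is in `L²`. -/
structure IsH2 (a : ℝ) (u v w : ℝ → ℂ) : Prop where
  memLp : MemLp w 2 (cellMeasure a)
  eq_u : ∀ x ∈ Icc (-a / 2) (a / 2), u x = u (-a / 2) + ∫ t in (-a / 2)..x, v t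
  eq_v : ∀ x ∈ Icc (-a / 2) (a / 2), v x = v (-a / 2) + ∫ t in (-a / 2)..x, w t

namespace IsH2

variable {a : ℝ} {u v w u₁ v₁ w₁ u₂ v₂ w₂ : ℝ → ℂ}

theorem integrableOn_w (h : IsH2 a u v w) : IntegrableOn w (Icc (-a / 2) (a / 2)) := by
  rw [integrableOn_Icc_iff_integrableOn_Ioo]
  exact h.memLp.integrable (by norm_num)

theorem continuousOn_v (h : IsH2 a u v w) : ContinuousOn v (Icc (-a / 2) (a / 2)) := by
  have h1 := intervalIntegral.continuousOn_primitive_Icc h.integrableOn_w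
  refine (continuousOn_const.add h1 : ContinuousOn
    (fun x => v (-a / 2) + ∫ t in Icc (-a / 2) x, w t) _).congr fun x hx => ?_
  simp only [Pi.add_apply]
  rw [h.eq_v x hx, intervalIntegral.integral_of_le hx.1, integral_Icc_eq_integral_Ioc]

theorem intervalIntegrable_v (h : IsH2 a u v w) {x : ℝ} (hx : x ∈ Icc (-a / 2) (a / 2)) :
    IntervalIntegrable v volume (-a / 2) x := by
  refine (h.continuousOn_v.mono ?_).intervalIntegrable
  rw [uIcc_of_le hx.1]
  exact Icc_subset_Icc_right hx.2

theorem intervalIntegrable_w (h : IsH2 a u v w) {x : ℝ} (hx : x ∈ Icc (-a / 2) (a / 2)) :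
    IntervalIntegrable w volume (-a / 2) x := by
  rw [intervalIntegrable_iff_integrableOn_Icc_of_le hx.1]
  exact h.integrableOn_w.mono_set (Icc_subset_Icc_right hx.2)

theorem add (h₁ : IsH2 a u₁ v₁ w₁) (h₂ : IsH2 a u₂ v₂ w₂) :
    IsH2 a (u₁ + u₂) (v₁ + v₂) (w₁ + w₂) where
  memLp := h₁.memLp.add h₂.memLp
  eq_u x hx := by
    simp only [Pi.add_apply]
    rw [intervalIntegral.integral_add (h₁.intervalIntegrable_v hx) (h₂.intervalIntegrable_v hx),
      h₁.eq_u x hx, h₂.eq_u x hx]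
    ring
  eq_v x hx := by
    simp only [Pi.add_apply]
    rw [intervalIntegral.integral_add (h₁.intervalIntegrable_w hx) (h₂.intervalIntegrable_w hx),
      h₁.eq_v x hx, h₂.eq_v x hx]
    ring

theorem smul (c : ℂ) (h : IsH2 a u v w) : IsH2 a (c • u) (c • v) (c • w) where
  memLp := h.memLp.const_smul c
  eq_u x hx := by
    simp only [Pi.smul_apply, smul_eq_mul]
    rw [intervalIntegral.integral_const_mul, h.eq_u x hx]
    ring
  eq_v x hx := by
    simp only [Pi.smul_apply, smul_eq_mul]
    rw [intervalIntegral.integral_const_mul, h.eq_v x hx]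
    ring

theorem zero : IsH2 a 0 0 0 where
  memLp := MemLp.zero
  eq_u x _ := by simp
  eq_v x _ := by simp

end IsH2

/-- The graph of the operator `-d²/dx² + V` in `L²((-a/2, a/2))` with domain
`{u ∈ H²((-a/2, a/2)) : u(a/2) = σ u(-a/2), u'(a/2) = σ u'(-a/2)}`. -/
def opGraph (a : ℝ) (V : ℝ → ℝ) (σ : ℂ) : Submodule ℂ (L2 a × L2 a) where
  carrier := {p | ∃ u v w : ℝ → ℂ, IsH2 a u v w ∧
    u (a / 2) = σ * u (-a / 2) ∧ v (a / 2) = σ * v (-a / 2) ∧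
    p.1 =ᵐ[cellMeasure a] u ∧
    p.2 =ᵐ[cellMeasure a] fun x => -w x + (V x : ℂ) * u x}
  zero_mem' := by
    refine ⟨0, 0, 0, IsH2.zero, by simp, by simp, Lp.coeFn_zero _ _ _, ?_⟩
    filter_upwards [Lp.coeFn_zero ℂ 2 (cellMeasure a)] with x hx
    simpa using hx
  add_mem' := by
    rintro ⟨f₁, g₁⟩ ⟨f₂, g₂⟩ ⟨u₁, v₁, w₁, h₁, hu₁, hv₁, hf₁, hg₁⟩ ⟨u₂, v₂, w₂, h₂, hu₂, hv₂, hf₂, hg₂⟩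
    refine ⟨u₁ + u₂, v₁ + v₂, w₁ + w₂, h₁.add h₂, ?_, ?_, ?_, ?_⟩
    · simp only [Pi.add_apply, hu₁, hu₂]; ring
    · simp only [Pi.add_apply, hv₁, hv₂]; ring
    · exact (Lp.coeFn_add f₁ f₂).trans (hf₁.add hf₂)
    · filter_upwards [Lp.coeFn_add g₁ g₂, hg₁, hg₂] with x hx h1 h2
      simp only [Prod.mk_add_mk, hx, Pi.add_apply] at *
      rw [h1, h2]; ring
  smul_mem' := by
    rintro c ⟨f, g⟩ ⟨u, v, w, h, hu, hv, hf, hg⟩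
    refine ⟨c • u, c • v, c • w, h.smul c, ?_, ?_, ?_, ?_⟩
    · simp only [Pi.smul_apply, hu, smul_eq_mul]; ring
    · simp only [Pi.smul_apply, hv, smul_eq_mul]; ring
    · exact (Lp.coeFn_smul c f).trans (hf.const_smul c)
    · filter_upwards [Lp.coeFn_smul c g, hg] with x hx h1
      simp only [Prod.smul_mk, hx, Pi.smul_apply, smul_eq_mul] at *
      rw [h1]; ring

/-- The eigenspace `{f : H f = z f}` of the operator `H` with graph `opGraph a V σ`. -/
def eigenspace (a : ℝ) (V : ℝ → ℝ) (σ : ℂ) (z : ℂ) : Submodule ℂ (L2 a) :=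
  (opGraph a V σ).comap (LinearMap.prod LinearMap.id (z • LinearMap.id))

/-- `ν 1 ≤ ν 2 ≤ …` is the sequence of all the eigenvalues, counted with multiplicity, of
`-d²/dx² + V` in `L²((-a/2, a/2))` with the boundary condition of `opGraph a V σ`: every complex
number `z` has finite multiplicity and occurs in the sequence exactly that many times.
(The value `ν 0` is not used.) -/
structure IsEigenvalueSequence (a : ℝ) (V : ℝ → ℝ) (σ : ℂ) (ν : ℕ → ℝ) : Prop where
  mono : ∀ i j : ℕ, 1 ≤ i → i ≤ j → ν i ≤ ν j
  finite : ∀ z : ℂ, FiniteDimensional ℂ (eigenspace a V σ z)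
  count : ∀ z : ℂ, {j : ℕ | 1 ≤ j ∧ (ν j : ℂ) = z}.encard
    = (Module.finrank ℂ (eigenspace a V σ z) : ℕ∞)

end Hill

end

noncomputable section

namespace Hill

open ComplexConjugate

/-! Put κ = nπ/a. Up to an error ε < c/4 in the sup norm, V is b + c cos 2(κx + t₀), where c =
√(a_n² + b_n²) and b is the mean of V. The leading harmonic has its maxima at the zeros of sin(κx +
t₀) and its minima at those of cos(κx + t₀). Both sets cut the period into n cells, and sin(κx + t₀)
satisfies the boundary condition with σ = (-1)^n, whence the parity in the theorem.

Upper bound for the n-th eigenvalue. The functions equal to a multiple of sin(κx + t₀) on each cell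
between maxima form an n-dimensional space in the form domain, on which the Rayleigh quotient is at
most b + κ² - c/2 + ε (`trial_energy_le`). Min-max (`IsResolvent.eigenvalue_le`) gives the same
bound for the eigenvalue.

Lower bound for the (n+1)-st eigenvalue. Some nonzero combination of the first n + 1 eigenfunctions
vanishes at the n minima (`IsResolvent.exists_vanishing`). Every function in the domain with these
zeros has Rayleigh quotient at least b + κ² - ε (`InDomain.energy_ge`). In the variable t = κx + t₀
+ π/2 this says that -d²/dt² - q cos 2t ≥ 1 for functions vanishing with sin t and 0 ≤ q = c/κ² ≤
12. The form is affine in q, so q = 0 and q = 12 suffice. Both follow from Jacobi's method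
(`jacobi_inequality`), with comparison functions sin t and sin t · p(cos 2t), p a positive cubic.
The gap is therefore at least c/2 - 2ε > 0.

The spectral theory is carried by the resolvent T = (H + M)⁻¹, which is bounded, symmetric and
compact (`exists_isResolvent`). Large eigenvalues of T are small eigenvalues of H, and a form bound
for a trial function becomes a lower bound for ⟨Tf, f⟩, so trial functions need not lie in the
operator domain. -/

/-! ### Absolutely continuous functions and integration by parts -/

theorem absolutelyContinuousOnInterval_congr {X : Type*} [PseudoMetricSpace X] {f g : ℝ → X}
    {l r : ℝ} (hf : AbsolutelyContinuousOnInterval f l r) (h : ∀ x ∈ uIcc l r, g x = f x) :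
    AbsolutelyContinuousOnInterval g l r := by
  rw [absolutelyContinuousOnInterval_iff] at hf ⊢
  intro ε hε
  obtain ⟨δ, hδ, H⟩ := hf ε hε
  refine ⟨δ, hδ, fun E hE hlt => ?_⟩
  refine lt_of_eq_of_lt (Finset.sum_congr rfl fun i hi => ?_) (H E hE hlt)
  have := hE.1 i hi
  rw [h _ this.1, h _ this.2]

theorem absolutelyContinuousOnInterval_integral {p : ℝ → ℂ} {l r : ℝ}
    (hp : IntervalIntegrable p volume l r) :
    AbsolutelyContinuousOnInterval (fun x => ∫ t in l..x, p t) l r := by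
  have hre : IntervalIntegrable (fun t => (p t).re) volume l r := ⟨hp.1.re, hp.2.re⟩
  have him : IntervalIntegrable (fun t => (p t).im) volume l r := ⟨hp.1.im, hp.2.im⟩
  have hc (z : ℂ) : AbsolutelyContinuousOnInterval (fun _ : ℝ => z) l r :=
    ((LipschitzWith.const z).lipschitzOnWith (s := uIcc l r)).absolutelyContinuousOnInterval
  have h1 := ((hre.absolutelyContinuousOnInterval_intervalIntegral left_mem_uIcc).fun_smul
    (hc 1)).fun_add
    ((him.absolutelyContinuousOnInterval_intervalIntegral left_mem_uIcc).fun_smul (hc Complex.I))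
  refine absolutelyContinuousOnInterval_congr h1 fun x hx => ?_
  have hx' : IntervalIntegrable p volume l x := hp.mono_set (uIcc_subset_uIcc_left hx)
  have e1 := Complex.reCLM.intervalIntegral_comp_comm hx'
  have e2 := Complex.imCLM.intervalIntegral_comp_comm hx'
  simp only [Complex.reCLM_apply, Complex.imCLM_apply] at e1 e2
  rw [e1, e2]
  simp [Complex.re_add_im]

/-- Integration by parts for two absolutely continuous functions, given as primitives. -/
theorem integral_mul_add_mul_eq_sub {A B p q : ℝ → ℂ} {l r : ℝ} (hlr : l ≤ r)
    (hp : IntervalIntegrable p volume l r) (hq : IntervalIntegrable q volume l r)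
    (hA : ∀ x ∈ Icc l r, A x = A l + ∫ t in l..x, p t)
    (hB : ∀ x ∈ Icc l r, B x = B l + ∫ t in l..x, q t) :
    ∫ x in l..r, (p x * B x + A x * q x) = A r * B r - A l * B l := by
  have hc (z : ℂ) : AbsolutelyContinuousOnInterval (fun _ : ℝ => z) l r :=
    ((LipschitzWith.const z).lipschitzOnWith (s := uIcc l r)).absolutelyContinuousOnInterval
  set A' : ℝ → ℂ := fun x => A l + ∫ t in l..x, p t with hA'
  set B' : ℝ → ℂ := fun x => B l + ∫ t in l..x, q t with hB'
  have aA : AbsolutelyContinuousOnInterval A' l r :=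
    (hc (A l)).fun_add (absolutelyContinuousOnInterval_integral hp)
  have aB : AbsolutelyContinuousOnInterval B' l r :=
    (hc (B l)).fun_add (absolutelyContinuousOnInterval_integral hq)
  have hint : IntervalIntegrable (fun x => p x * B' x + A' x * q x) volume l r :=
    (hp.mul_continuousOn aB.continuousOn).add (hq.continuousOn_mul aA.continuousOn)
  have aG := (aA.fun_smul aB).fun_sub (absolutelyContinuousOnInterval_integral hint)
  -- The product minus the primitive of its formal derivative is absolutely continuous with zero
  -- derivative almost everywhere, hence constant; its values at `l` and `r` give the formula.
  obtain ⟨C, hC⟩ := aG.const_of_ae_hasDerivAt_zero (by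
    filter_upwards [hp.ae_hasDerivAt_integral, hq.ae_hasDerivAt_integral,
      hint.ae_hasDerivAt_integral] with x h1 h2 h3 hx
    have d1 : HasDerivAt A' (p x) x := (h1 hx l left_mem_uIcc).const_add _
    have d2 : HasDerivAt B' (q x) x := (h2 hx l left_mem_uIcc).const_add _
    have := (d1.mul d2).sub (h3 hx l left_mem_uIcc)
    rw [sub_self] at this
    exact this)
  have e1 := hC l left_mem_uIcc
  have e2 := hC r right_mem_uIcc
  simp only [intervalIntegral.integral_same, sub_zero, smul_eq_mul] at e1 e2
  have e3 : ∫ x in l..r, (p x * B x + A x * q x) = ∫ x in l..r, (p x * B' x + A' x * q x) := by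
    refine intervalIntegral.integral_congr fun x hx => ?_
    rw [uIcc_of_le hlr] at hx
    simp only [hA', hB']
    rw [hA x hx, hB x hx]
  have fA : A' r = A r := (hA r (right_mem_Icc.2 hlr)).symm
  have fB : B' r = B r := (hB r (right_mem_Icc.2 hlr)).symm
  have gA : A' l = A l := (hA l (left_mem_Icc.2 hlr)).symm
  have gB : B' l = B l := (hB l (left_mem_Icc.2 hlr)).symm
  rw [fA, fB] at e2
  rw [gA, gB] at e1
  rw [e3, e1]
  linear_combination -e2

/-! ### The cell measure, the form domain and Green's formula -/

theorem integral_cellMeasure {E : Type*} [NormedAddCommGroup E] [NormedSpace ℝ E] {a : ℝ}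
    (ha : 0 < a) (f : ℝ → E) :
    ∫ x, f x ∂(cellMeasure a) = ∫ x in (-a / 2)..(a / 2), f x := by
  rw [intervalIntegral.integral_of_le (by linarith), integral_Ioc_eq_integral_Ioo]

theorem integrable_cellMeasure_iff {E : Type*} [NormedAddCommGroup E] {a : ℝ}
    (ha : 0 < a) {f : ℝ → E} :
    Integrable f (cellMeasure a) ↔ IntervalIntegrable f volume (-a / 2) (a / 2) := by
  rw [intervalIntegrable_iff_integrableOn_Ioo_of_le (by linarith)]
  rfl

instance (a : ℝ) : IsFiniteMeasure (cellMeasure a) :=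
  ⟨by simp [cellMeasure]⟩

theorem ae_cellMeasure_of_forall_mem {a : ℝ} {p : ℝ → Prop}
    (h : ∀ x ∈ Icc (-a / 2) (a / 2), p x) : ∀ᵐ x ∂(cellMeasure a), p x :=
  (ae_restrict_iff' measurableSet_Ioo).2 (.of_forall fun x hx => h x (Ioo_subset_Icc_self hx))

theorem memLp_of_continuousOn {a : ℝ} {f : ℝ → ℂ} (hf : ContinuousOn f (Icc (-a / 2) (a / 2))) :
    MemLp f 2 (cellMeasure a) := by
  obtain ⟨C, hC⟩ := isCompact_Icc.exists_bound_of_continuousOn hf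
  refine MemLp.of_bound ((hf.mono Ioo_subset_Icc_self).aestronglyMeasurable measurableSet_Ioo) C ?_
  exact ae_cellMeasure_of_forall_mem hC

theorem IsH2.continuousOn_u {a : ℝ} {u v w : ℝ → ℂ} (h : IsH2 a u v w) :
    ContinuousOn u (Icc (-a / 2) (a / 2)) := by
  have h1 := intervalIntegral.continuousOn_primitive_Icc
    (h.continuousOn_v.integrableOn_compact (μ := volume) isCompact_Icc)
  refine (continuousOn_const.add h1 : ContinuousOn
    (fun x => u (-a / 2) + ∫ t in Icc (-a / 2) x, v t) _).congr fun x hx => ?_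
  simp only [Pi.add_apply]
  rw [h.eq_u x hx, intervalIntegral.integral_of_le hx.1, integral_Icc_eq_integral_Ioc]

theorem intervalIntegral_conj (f : ℝ → ℂ) (l r : ℝ) :
    ∫ x in l..r, conj (f x) = conj (∫ x in l..r, f x) := by
  simp only [intervalIntegral, map_sub, integral_conj]

theorem intervalIntegrable_conj {f : ℝ → ℂ} {l r : ℝ} (h : IntervalIntegrable f volume l r) :
    IntervalIntegrable (fun x => conj (f x)) volume l r :=
  ⟨(Complex.conjCLE.toContinuousLinearMap.integrable_comp h.1 :),
    (Complex.conjCLE.toContinuousLinearMap.integrable_comp h.2 :)⟩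

/-- `f` is the primitive of the square integrable function `f'` on `[-a/2, a/2]` and satisfies the
quasi-periodic boundary condition `f (a/2) = σ f (-a/2)`. -/
structure IsFormFunction (a : ℝ) (σ : ℂ) (f f' : ℝ → ℂ) : Prop where
  memLp : MemLp f' 2 (cellMeasure a)
  eq_f : ∀ x ∈ Icc (-a / 2) (a / 2), f x = f (-a / 2) + ∫ t in (-a / 2)..x, f' t
  bc : f (a / 2) = σ * f (-a / 2)
  continuousOn : ContinuousOn f (Icc (-a / 2) (a / 2))

/-- Function-level domain of the operator: a representative together with its two derivatives. -/
structure InDomain (a : ℝ) (σ : ℂ) (u v w : ℝ → ℂ) : Prop where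
  isH2 : IsH2 a u v w
  bc_u : u (a / 2) = σ * u (-a / 2)
  bc_v : v (a / 2) = σ * v (-a / 2)

theorem InDomain.isFormFunction {a : ℝ} {σ : ℂ} {u v w : ℝ → ℂ} (h : InDomain a σ u v w) :
    IsFormFunction a σ u v where
  memLp := memLp_of_continuousOn h.isH2.continuousOn_v
  eq_f := h.isH2.eq_u
  bc := h.bc_u
  continuousOn := h.isH2.continuousOn_u

/-- Green's formula; the boundary terms cancel. -/
theorem InDomain.integral_conj_mul {a : ℝ} (ha : 0 < a) {σ : ℂ} (hσ : conj σ * σ = 1)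
    {u v w f f' : ℝ → ℂ} (h : InDomain a σ u v w) (hf : IsFormFunction a σ f f') :
    ∫ x, conj (w x) * f x ∂(cellMeasure a) = -∫ x, conj (v x) * f' x ∂(cellMeasure a) := by
  have hlr : -a / 2 ≤ a / 2 := by linarith
  have hw := h.isH2.intervalIntegrable_w (right_mem_Icc.2 hlr)
  have hf' : IntervalIntegrable f' volume (-a / 2) (a / 2) :=
    (integrable_cellMeasure_iff ha).1 (hf.memLp.integrable (by norm_num))
  have key := integral_mul_add_mul_eq_sub (A := fun x => conj (v x)) (B := f) hlr
    (intervalIntegrable_conj hw) hf' (fun x hx => by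
      rw [h.isH2.eq_v x hx, map_add, intervalIntegral_conj]) hf.eq_f
  have hcv : ContinuousOn (fun x => conj (v x)) (uIcc (-a / 2) (a / 2)) := by
    rw [uIcc_of_le hlr]
    exact Complex.continuous_conj.comp_continuousOn h.isH2.continuousOn_v
  have hcf : ContinuousOn f (uIcc (-a / 2) (a / 2)) := by
    rw [uIcc_of_le hlr]; exact hf.continuousOn
  rw [intervalIntegral.integral_add ((intervalIntegrable_conj hw).mul_continuousOn hcf)
    (hf'.continuousOn_mul hcv), hf.bc, h.bc_v, map_mul] at key
  rw [integral_cellMeasure ha, integral_cellMeasure ha]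
  linear_combination key + conj (v (-a / 2)) * f (-a / 2) * hσ

theorem InDomain.add {a : ℝ} {σ : ℂ} {u v w u₁ v₁ w₁ : ℝ → ℂ} (h : InDomain a σ u v w)
    (h₁ : InDomain a σ u₁ v₁ w₁) : InDomain a σ (u + u₁) (v + v₁) (w + w₁) where
  isH2 := h.isH2.add h₁.isH2
  bc_u := by simp only [Pi.add_apply, h.bc_u, h₁.bc_u]; ring
  bc_v := by simp only [Pi.add_apply, h.bc_v, h₁.bc_v]; ring

theorem InDomain.smul {a : ℝ} {σ : ℂ} {u v w : ℝ → ℂ} (c : ℂ) (h : InDomain a σ u v w) :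
    InDomain a σ (c • u) (c • v) (c • w) where
  isH2 := h.isH2.smul c
  bc_u := by simp only [Pi.smul_apply, h.bc_u, smul_eq_mul]; ring
  bc_v := by simp only [Pi.smul_apply, h.bc_v, smul_eq_mul]; ring

theorem InDomain.sum {a : ℝ} {σ : ℂ} {ι : Type*} (s : Finset ι) {u v w : ι → ℝ → ℂ} (c : ι → ℂ)
    (h : ∀ i ∈ s, InDomain a σ (u i) (v i) (w i)) :
    InDomain a σ (∑ i ∈ s, c i • u i) (∑ i ∈ s, c i • v i) (∑ i ∈ s, c i • w i) := by
  classical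
  induction s using Finset.induction_on with
  | empty => exact ⟨IsH2.zero, by simp, by simp⟩
  | insert i s hi ih =>
    simp only [Finset.sum_insert hi]
    exact ((h i (Finset.mem_insert_self i s)).smul (c i)).add
      (ih fun j hj => h j (Finset.mem_insert_of_mem hj))

/-! ### Solving -u″ + m²u = f -/

/-- First order boundary value problem `y' = m y + f`, `y (a/2) = σ y (-a/2)`. -/
theorem exists_first_order {a : ℝ} (ha : 0 < a) {σ : ℂ} (hσ : conj σ * σ = 1) {m : ℝ} (hm : m ≠ 0)
    {f : ℝ → ℂ} (hf : IntervalIntegrable f volume (-a / 2) (a / 2)) :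
    ∃ y : ℝ → ℂ, ContinuousOn y (Icc (-a / 2) (a / 2)) ∧ y (a / 2) = σ * y (-a / 2) ∧
      ∀ x ∈ Icc (-a / 2) (a / 2), y x = y (-a / 2) + ∫ t in (-a / 2)..x, (m * y t + f t) := by
  have hlr : -a / 2 ≤ a / 2 := by linarith
  set E : ℝ → ℂ := fun x => Complex.exp (m * x) with hE
  set E' : ℝ → ℂ := fun x => Complex.exp (-(m * x)) with hE'
  have hEE : ∀ x, E x * E' x = 1 := fun x => by
    simp only [hE, hE', ← Complex.exp_add]; simp
  have cE : Continuous E := by fun_prop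
  have cE' : Continuous E' := by fun_prop
  have hq : IntervalIntegrable (fun t => E' t * f t) volume (-a / 2) (a / 2) :=
    hf.continuousOn_mul cE'.continuousOn
  -- Unique solvability: as |σ| = 1, equality would force e^{ma/2} = e^{-ma/2}, impossible for m ≠
  -- 0.
  have hne : E (a / 2) - σ * E (-a / 2) ≠ 0 := by
    intro h0
    have hσ1 : ‖σ‖ = 1 := by
      have : ‖conj σ * σ‖ = 1 := by rw [hσ]; simp
      rw [norm_mul, RCLike.norm_conj] at this
      nlinarith [norm_nonneg σ]
    have h1 : ‖E (a / 2)‖ = ‖E (-a / 2)‖ := by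
      rw [sub_eq_zero.1 h0, norm_mul, hσ1, one_mul]
    simp only [hE, Complex.norm_exp] at h1
    have h2 := Real.exp_injective h1
    simp only [Complex.mul_re, Complex.ofReal_re, Complex.ofReal_im, zero_mul, sub_zero] at h2
    norm_num at h2
    rcases h2 with h2 | h2
    · linarith
    · exact hm h2
  set F : ℝ → ℂ := fun x => ∫ t in (-a / 2)..x, E' t * f t with hF
  -- Variation of constants gives y = E(α + F); the boundary condition determines α.
  set α : ℂ := -(E (a / 2) * F (a / 2)) / (E (a / 2) - σ * E (-a / 2)) with hα
  have hF0 : F (-a / 2) = 0 := by simp [hF]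
  have cF : ContinuousOn F (Icc (-a / 2) (a / 2)) := by
    have := (absolutelyContinuousOnInterval_integral hq).continuousOn
    rwa [uIcc_of_le hlr] at this
  refine ⟨fun x => E x * (α + F x), cE.continuousOn.mul (continuousOn_const.add cF), ?_, ?_⟩
  · have : α * (E (a / 2) - σ * E (-a / 2)) = -(E (a / 2) * F (a / 2)) := by
      rw [hα, div_mul_cancel₀ _ hne]
    simp only [hF0]
    linear_combination this
  · intro x hx
    have hd : ∀ t, HasDerivAt E (m * E t) t := fun t => by
      have := ((Complex.ofRealCLM.hasDerivAt (x := t)).const_mul (m : ℂ)).cexp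
      simp only [Complex.ofRealCLM_apply, Complex.ofReal_one, mul_one] at this
      rw [mul_comm] at this
      exact this
    have cd : Continuous fun t => (m : ℂ) * E t := continuous_const.mul cE
    have key := integral_mul_add_mul_eq_sub (A := E) (B := fun x => α + F x)
      (p := fun t => m * E t) (q := fun t => E' t * f t) hx.1 (cd.intervalIntegrable _ _)
      (hq.mono_set (by rw [uIcc_of_le hx.1, uIcc_of_le hlr]; exact Icc_subset_Icc_right hx.2))
      (fun y _ => by
        rw [intervalIntegral.integral_eq_sub_of_hasDerivAt (fun t _ => hd t)
          (cd.intervalIntegrable _ _)]; ring)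
      (fun y _ => by rw [hF0]; simp [hF])
    have e : ∫ t in (-a / 2)..x, (m * (E t * (α + F t)) + f t)
        = ∫ t in (-a / 2)..x, (m * E t * (α + F t) + E t * (E' t * f t)) := by
      refine intervalIntegral.integral_congr fun t _ => ?_
      rw [← mul_assoc (E t) (E' t), hEE]; ring
    rw [e, key]; ring

/-- Solvability of `-u'' + m² u = f` under the quasi-periodic boundary condition. -/
theorem exists_inDomain {a : ℝ} (ha : 0 < a) {σ : ℂ} (hσ : conj σ * σ = 1) {m : ℝ} (hm : m ≠ 0)
    {f : ℝ → ℂ} (hf : MemLp f 2 (cellMeasure a)) :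
    ∃ u v w : ℝ → ℂ, InDomain a σ u v w ∧ ∀ x, -w x + (m ^ 2 : ℝ) * u x = f x := by
  have hlr : -a / 2 ≤ a / 2 := by linarith
  have hfi : IntervalIntegrable f volume (-a / 2) (a / 2) :=
    (integrable_cellMeasure_iff ha).1 (hf.integrable (by norm_num))
  -- The operator factors as -(d/dx - m)(d/dx + m): solve y' = my - f, then u' = -mu + y.
  obtain ⟨y, cy, by1, hy⟩ := exists_first_order ha hσ hm hfi.neg
  have cy' : ContinuousOn y (uIcc (-a / 2) (a / 2)) := by rwa [uIcc_of_le hlr]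
  obtain ⟨u, cu, bu, hu⟩ := exists_first_order ha hσ (neg_ne_zero.2 hm) cy'.intervalIntegrable
  have cu' : ContinuousOn u (uIcc (-a / 2) (a / 2)) := by rwa [uIcc_of_le hlr]
  refine ⟨u, fun x => (-m : ℝ) * u x + y x, fun x => (m ^ 2 : ℝ) * u x - f x,
    ⟨⟨?_, hu, ?_⟩, bu, ?_⟩, fun x => by ring⟩
  · exact (memLp_of_continuousOn (continuousOn_const.mul cu)).sub hf
  · intro x hx
    have hsub : uIcc (-a / 2) x ⊆ uIcc (-a / 2) (a / 2) := by
      rw [uIcc_of_le hlr, uIcc_of_le hx.1]; exact Icc_subset_Icc_right hx.2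
    have i1 : IntervalIntegrable (fun t => (-m : ℝ) * u t + y t) volume (-a / 2) x :=
      ((continuousOn_const.mul (cu'.mono hsub)).add (cy'.mono hsub)).intervalIntegrable
    have i2 : IntervalIntegrable (fun t => m * y t + (-f) t) volume (-a / 2) x :=
      ((continuousOn_const.mul (cy'.mono hsub)).intervalIntegrable).add
        (hfi.neg.mono_set hsub)
    have e : ∫ t in (-a / 2)..x, ((m ^ 2 : ℝ) * u t - f t)
        = (-m : ℝ) * (∫ t in (-a / 2)..x, ((-m : ℝ) * u t + y t))
          + ∫ t in (-a / 2)..x, (m * y t + (-f) t) := by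
      rw [← intervalIntegral.integral_const_mul, ← intervalIntegral.integral_add
        (i1.const_mul _) i2]
      refine intervalIntegral.integral_congr fun t _ => ?_
      simp only [Pi.neg_apply]; push_cast; ring
    rw [e]
    linear_combination ((-m : ℝ) : ℂ) * hu x hx + hy x hx
  · rw [bu, by1]; ring

/-! ### Compactness and Rayleigh bounds in an abstract Hilbert space -/

section Hilbert

variable {E : Type*} [NormedAddCommGroup E] [InnerProductSpace ℂ E]

/-- A linear relation that is bounded below and surjective is the graph of the inverse of a bounded
operator. -/
theorem exists_resolvent (G : Submodule ℂ (E × E)) {c : ℝ} (hc : 0 < c)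
    (hb : ∀ f g, (f, g) ∈ G → c * ‖f‖ ≤ ‖g‖) (hs : ∀ g, ∃ f, (f, g) ∈ G) :
    ∃ T : E →L[ℂ] E, (∀ f g, (f, g) ∈ G ↔ f = T g) ∧ ‖T‖ ≤ c⁻¹ := by
  choose t ht using hs
  have huniq : ∀ f g, (f, g) ∈ G → f = t g := fun f g h => by
    have h1 : (f - t g, (0 : E)) ∈ G := by
      have := G.sub_mem h (ht g)
      rwa [Prod.mk_sub_mk, sub_self] at this
    have h2 := hb _ _ h1
    rw [norm_zero] at h2
    have h3 : ‖f - t g‖ ≤ 0 := by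
      by_contra h4
      push Not at h4
      nlinarith [mul_pos hc h4]
    exact sub_eq_zero.1 (norm_le_zero_iff.1 h3)
  let T₀ : E →ₗ[ℂ] E :=
    { toFun := t
      map_add' := fun x y => (huniq _ _ (by simpa using G.add_mem (ht x) (ht y))).symm
      map_smul' := fun r x => (huniq _ _ (by simpa using G.smul_mem r (ht x))).symm }
  have hbd : ∀ x, ‖T₀ x‖ ≤ c⁻¹ * ‖x‖ := fun x => by
    rw [le_inv_mul_iff₀ hc]; exact hb _ _ (ht x)
  refine ⟨T₀.mkContinuous c⁻¹ hbd, fun f g => ⟨huniq f g, ?_⟩,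
    LinearMap.mkContinuous_norm_le _ (by positivity) _⟩
  rintro rfl
  exact ht g

/-- An equation `f = T (h - B f)` with a small perturbation `B` is solvable. -/
theorem exists_eq_apply_sub [CompleteSpace E] (T B : E →L[ℂ] E) (h : ‖T‖ * ‖B‖ < 1) (g : E) :
    ∃ f, f = T (g - B f) := by
  have hn : ‖-(T * B)‖ < 1 := by
    rw [norm_neg]; exact (norm_mul_le T B).trans_lt h
  -- Neumann series: 1 + TB is invertible, and f = (1 + TB)⁻¹Tg solves f + TBf = Tg.
  set U := Units.oneSub (-(T * B)) hn
  have hU : (U : E →L[ℂ] E) = 1 + T * B := by simp [U]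
  refine ⟨(↑U⁻¹ : E →L[ℂ] E) (T g), ?_⟩
  have h1 : (U : E →L[ℂ] E) ((↑U⁻¹ : E →L[ℂ] E) (T g)) = T g := by
    rw [← mul_apply_eq_comp, Units.mul_inv]; rfl
  rw [hU] at h1
  simp only [add_apply, mul_apply_eq_comp,
    one_apply_eq_self] at h1
  rw [map_sub]
  exact eq_sub_of_add_eq h1

/-- `T` is small on subspaces of finite codimension. -/
def SmallOnFiniteCodim (T : E →L[ℂ] E) : Prop :=
  ∀ ε : ℝ, 0 < ε → ∃ (N : ℕ) (φ : Fin N → E), ∀ f, (∀ i, inner ℂ (φ i) f = 0) → ‖T f‖ ≤ ε * ‖f‖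

/-- With P the projection onto the span of the finitely many test vectors, TP has finite rank and ‖T
- TP‖ is small, so T is a norm limit of compact operators. -/
theorem SmallOnFiniteCodim.isCompactOperator [CompleteSpace E] {T : E →L[ℂ] E}
    (hT : SmallOnFiniteCodim T) : IsCompactOperator T := by
  have hcl : IsClosed {f : E →L[ℂ] E | IsCompactOperator f} := isClosed_setOfPred_isCompactOperator
  have : T ∈ closure {f : E →L[ℂ] E | IsCompactOperator f} := by
    rw [Metric.mem_closure_iff]
    intro ε hε
    obtain ⟨N, φ, hφ⟩ := hT (ε / 2) (by positivity)
    set K : Submodule ℂ E := Submodule.span ℂ (range φ) with hK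
    have : FiniteDimensional ℂ K := FiniteDimensional.span_of_finite ℂ (finite_range φ)
    refine ⟨T ∘L K.starProjection, ?_, ?_⟩
    · have h1 : IsCompactOperator (K.orthogonalProjectionOnto) :=
        isCompactOperator_of_locallyCompactSpace_dom _
      exact h1.clm_comp (T ∘L K.subtypeL)
    · rw [dist_eq_norm]
      refine lt_of_le_of_lt (ContinuousLinearMap.opNorm_le_bound _ (by positivity) fun f => ?_)
        (half_lt_self hε)
      have e : (T - T ∘L K.starProjection) f = T (f - K.starProjection f) := by simp
      rw [e]
      have hperp : f - K.starProjection f ∈ Kᗮ := K.sub_starProjection_mem_orthogonal f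
      refine (hφ _ fun i => (Submodule.mem_orthogonal K _).1 hperp _
        (Submodule.subset_span (mem_range_self i))).trans ?_
      gcongr
      have := K.norm_sq_eq_add_norm_sq_starProjection f
      have h2 : Kᗮ.starProjection f = f - K.starProjection f := by
        rw [Submodule.starProjection_orthogonal]; simp
      rw [h2] at this
      exact abs_le_of_sq_le_sq' (by nlinarith [sq_nonneg ‖K.starProjection f‖]) (norm_nonneg _) |>.2
  rwa [hcl.closure_eq] at this

theorem norm_sum_smul_sq {ι : Type*} [Fintype ι] {e : ι → E} (he : Orthonormal ℂ e) (c : ι → ℂ) :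
    ‖∑ i, c i • e i‖ ^ 2 = ∑ i, ‖c i‖ ^ 2 := by
  have h := he.inner_sum c c Finset.univ
  have h2 : ((‖∑ i, c i • e i‖ ^ 2 : ℝ) : ℂ) = ((∑ i, ‖c i‖ ^ 2 : ℝ) : ℂ) := by
    have h3 := inner_self_eq_norm_sq_to_K (𝕜 := ℂ) (∑ i, c i • e i)
    push_cast
    rw [h] at h3
    refine h3.symm.trans ?_
    refine Finset.sum_congr rfl fun i _ => ?_
    rw [Complex.conj_mul']
  exact_mod_cast h2

/-- The dimension count behind both sides of the min-max principle: fewer linear conditions than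
unknowns. -/
theorem exists_ne_zero_orthogonal {ι : Type*} [Fintype ι] {F : Type*} [AddCommGroup F]
    [Module ℂ F] [FiniteDimensional ℂ F] (φ : ι → F →ₗ[ℂ] ℂ)
    (h : Fintype.card ι < Module.finrank ℂ F) : ∃ c : F, c ≠ 0 ∧ ∀ i, φ i c = 0 := by
  have := LinearMap.ker_ne_bot_of_finrank_lt (f := LinearMap.pi φ) (by simpa using h)
  obtain ⟨c, hc, h0⟩ := Submodule.exists_mem_ne_zero_of_ne_bot this
  exact ⟨c, h0, fun i => congrFun (LinearMap.mem_ker.1 hc) i⟩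

/-- The number of eigenvalues above a positive threshold is bounded. -/
theorem SmallOnFiniteCodim.card_le {T : E →L[ℂ] E} (hT : SmallOnFiniteCodim T) {t : ℝ}
    (ht : 0 < t) : ∃ N : ℕ, ∀ (ι : Type) [Fintype ι] (e : ι → E) (μ : ι → ℝ), Orthonormal ℂ e →
      (∀ i, T (e i) = (μ i : ℂ) • e i) → (∀ i, t ≤ μ i) → Fintype.card ι ≤ N := by
  -- More than `N` eigenvectors would have a nonzero combination f orthogonal to every φ i; then
  -- ‖Tf‖ ≥ t‖f‖ contradicts ‖Tf‖ ≤ (t/2)‖f‖.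
  obtain ⟨N, φ, hφ⟩ := hT (t / 2) (by positivity)
  refine ⟨N, fun ι _ e μ he hμ hle => ?_⟩
  by_contra hlt
  push Not at hlt
  obtain ⟨c, hc0, hc⟩ := exists_ne_zero_orthogonal (F := ι → ℂ)
    (fun i : Fin N => (innerₛₗ ℂ (φ i)) ∘ₗ (Fintype.linearCombination ℂ e)) (by simpa using hlt)
  have hf : ∀ i, inner ℂ (φ i) (∑ j, c j • e j) = 0 := fun i => by
    have := hc i
    rwa [LinearMap.comp_apply, Fintype.linearCombination_apply, innerₛₗ_apply_apply] at this
  have h1 := hφ _ hf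
  have h2 : T (∑ j, c j • e j) = ∑ j, (c j * μ j) • e j := by
    rw [map_sum]
    refine Finset.sum_congr rfl fun j _ => ?_
    rw [map_smul, hμ, smul_smul]
  have h3 : t ^ 2 * ‖∑ j, c j • e j‖ ^ 2 ≤ ‖T (∑ j, c j • e j)‖ ^ 2 := by
    rw [h2, norm_sum_smul_sq he, norm_sum_smul_sq he, Finset.mul_sum]
    refine Finset.sum_le_sum fun j _ => ?_
    rw [norm_mul, mul_pow, Complex.norm_real, Real.norm_eq_abs, sq_abs, mul_comm]
    gcongr
    exact hle j
  have hpos : 0 < ‖∑ j, c j • e j‖ ^ 2 := by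
    rw [norm_sum_smul_sq he]
    obtain ⟨j, hj⟩ := Function.ne_iff.1 hc0
    exact Finset.sum_pos' (fun _ _ => by positivity)
      ⟨j, Finset.mem_univ j, by have := norm_pos_iff.2 hj; positivity⟩
  have h4 : ‖T (∑ j, c j • e j)‖ ^ 2 ≤ (t / 2 * ‖∑ j, c j • e j‖) ^ 2 :=
    pow_le_pow_left₀ (norm_nonneg _) h1 2
  nlinarith [mul_pos (mul_pos ht ht) hpos]

/-- Rayleigh quotient bound for a compact symmetric operator without eigenvalues above `t`. -/
theorem rayleigh_le_of_forall_eigenvalue [CompleteSpace E] {S : E →L[ℂ] E}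
    (hSc : IsCompactOperator S) (hSs : (S : E →ₗ[ℂ] E).IsSymmetric) {t : ℝ} (ht : 0 ≤ t)
    (h : ∀ μ : ℝ, t < μ → ∀ e : E, S e = (μ : ℂ) • e → e = 0) (f : E) :
    (inner ℂ (S f) f).re ≤ t * ‖f‖ ^ 2 := by
  have hSa : IsSelfAdjoint S := hSs.isSelfAdjoint
  -- For a self-adjoint operator this order relation is a statement about the spectrum, and nonzero
  -- spectral points of a compact operator are eigenvalues.
  have hle : S ≤ algebraMap ℝ (E →L[ℂ] E) t := by
    rw [le_algebraMap_iff_spectrum_le]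
    intro x hx
    by_contra hlt
    push Not at hlt
    have hx0 : (x : ℂ) ≠ 0 := by exact_mod_cast (ht.trans_lt hlt).ne'
    have hx' : (x : ℂ) ∈ spectrum ℂ S := (spectrum.algebraMap_mem_iff ℂ).2 hx
    rw [← hSc.hasEigenvalue_iff_mem_spectrum hx0] at hx'
    obtain ⟨e, he⟩ := hx'.exists_hasEigenvector
    exact he.2 (h x hlt e he.apply_eq_smul)
  rw [ContinuousLinearMap.le_def] at hle
  have h := hle.re_inner_nonneg_left f
  have e1 : inner ℂ ((algebraMap ℝ (E →L[ℂ] E) t - S) f) f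
      = ((t * ‖f‖ ^ 2 : ℝ) : ℂ) - inner ℂ (S f) f := by
    rw [sub_apply, inner_sub_left]
    congr 1
    rw [Algebra.algebraMap_eq_smul_one]
    rw [show (t • (1 : E →L[ℂ] E)) f = (t : ℂ) • f from rfl, inner_smul_left,
      inner_self_eq_norm_sq_to_K]
    simp
  rw [e1, RCLike.re_eq_complex_re, Complex.sub_re, Complex.ofReal_re] at h
  linarith

/-- Rayleigh quotient bound on the orthogonal complement of the eigenvectors with large
eigenvalues. -/
theorem rayleigh_le [CompleteSpace E] {T : E →L[ℂ] E} (hT : IsCompactOperator T)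
    (hs : (T : E →ₗ[ℂ] E).IsSymmetric) {t : ℝ} (ht : 0 ≤ t) {f : E}
    (hf : ∀ μ : ℝ, t < μ → ∀ e : E, T e = (μ : ℂ) • e → inner ℂ e f = 0) :
    (inner ℂ (T f) f).re ≤ t * ‖f‖ ^ 2 := by
  -- `X` is closed and, by symmetry, invariant under `T`; the restriction of `T` to it has no
  -- eigenvalue above `t`.
  set X : Submodule ℂ E :=
    ⨅ μ : {μ : ℝ // t < μ}, (Module.End.eigenspace (T : Module.End ℂ E) (μ : ℝ))ᗮ with hX
  have memX : ∀ g, g ∈ X ↔ ∀ μ : ℝ, t < μ → ∀ e : E, T e = (μ : ℂ) • e → inner ℂ e g = 0 := by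
    intro g
    simp [hX, Submodule.mem_iInf, Submodule.mem_orthogonal]
  have hinv : ∀ g ∈ X, T g ∈ X := by
    intro g hg
    rw [memX] at hg ⊢
    intro μ hμ e he
    have : inner ℂ (T e) g = inner ℂ e (T g) := hs e g
    rw [← this, he, inner_smul_left, hg μ hμ e he, mul_zero]
  have : CompleteSpace X := by
    rw [hX, Submodule.iInf_orthogonal]
    infer_instance
  set S : X →L[ℂ] X := T.restrict hinv with hS
  have hSc : IsCompactOperator S := IsCompactOperator.restrict' (f := (T : E →ₗ[ℂ] E)) hT hinv
  have hSs : (S : X →ₗ[ℂ] X).IsSymmetric := hs.restrict_invariant hinv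
  refine rayleigh_le_of_forall_eigenvalue hSc hSs ht (fun x hlt e he => ?_) ⟨f, (memX f).2 hf⟩
  have he1 : T (e : E) = (x : ℂ) • (e : E) := congrArg Subtype.val he
  have := (memX e).1 e.2 x hlt e he1
  rw [inner_self_eq_zero] at this
  exact Subtype.ext this

end Hilbert

/-! ### Enumeration of eigenvalues with multiplicity -/

/-- A locally finite family of multiplicities on the line, finite towards `-∞` and of infinite total
mass, can be enumerated in nondecreasing order. -/
theorem exists_enumeration (m : ℝ → ℕ) (hfin : ∀ R : ℝ, {z | z ≤ R ∧ m z ≠ 0}.Finite)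
    (hinf : {z | m z ≠ 0}.Infinite) :
    ∃ ν : ℕ → ℝ, (∀ i j : ℕ, 1 ≤ i → i ≤ j → ν i ≤ ν j) ∧
      ∀ z : ℝ, {j : ℕ | 1 ≤ j ∧ ν j = z}.encard = m z := by
  -- One point (z, i) for each of the `m z` copies of z, ordered lexicographically. Initial segments
  -- are finite and the set is infinite, so it is order isomorphic to ℕ.
  let P := {p : ℝ ×ₗ ℕ // (ofLex p).2 < m (ofLex p).1}
  let : LinearOrder P := inferInstance
  have hIic : ∀ p : P, (Iic p).Finite := by
    intro p
    have h1 : (⋃ z ∈ {z | z ≤ (ofLex p.1).1 ∧ m z ≠ 0},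
        (fun i : ℕ => (toLex (z, i) : ℝ ×ₗ ℕ)) '' Iio (m z)).Finite :=
      (hfin _).biUnion fun z _ => (finite_Iio (m z)).image _
    refine Finite.of_finite_image (f := Subtype.val) (h1.subset ?_) Subtype.val_injective.injOn
    rintro _ ⟨q, hq, rfl⟩
    have hle : (ofLex q.1).1 ≤ (ofLex p.1).1 := Prod.Lex.monotone_fst (α := ℝ) (β := ℕ) _ _ hq
    simp only [mem_iUnion]
    exact ⟨(ofLex q.1).1, ⟨hle, by have := q.2; omega⟩, (ofLex q.1).2, q.2, rfl⟩
  have : Infinite P := by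
    have hinf' := hinf.to_subtype
    refine Infinite.of_injective (fun z : {z | m z ≠ 0} =>
      (⟨toLex (z.1, 0), Nat.pos_of_ne_zero z.2⟩ : P)) fun z w h => ?_
    have := congrArg (fun p : P => (ofLex p.1).1) h
    exact Subtype.ext this
  let : LocallyFiniteOrder P := LocallyFiniteOrder.ofFiniteIcc fun p q =>
    (hIic q).subset Icc_subset_Iic_self
  let : SuccOrder P := LinearLocallyFiniteOrder.succOrder P
  let : PredOrder P := LinearLocallyFiniteOrder.predOrder P
  have : NoMaxOrder P := ⟨fun p => by
    by_contra h
    push Not at h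
    exact infinite_univ ((hIic p).subset fun q _ => h q)⟩
  let : OrderBot P := by
    have hex : ∃ b : P, ∀ q, b ≤ q := by
      obtain ⟨p₀⟩ : Nonempty P := inferInstance
      obtain ⟨b, hb, hmin⟩ := (hIic p₀).exists_minimal ⟨p₀, le_refl p₀⟩
      refine ⟨b, fun q => ?_⟩
      rcases le_total b q with h | h
      · exact h
      · exact hmin (h.trans hb) h
    exact { bot := hex.choose, bot_le := hex.choose_spec }
  let φ : P ≃o ℕ := orderIsoNatOfLinearSuccPredArch
  refine ⟨fun j => (ofLex (φ.symm (j - 1)).1).1, fun i j _ hij => ?_, fun z => ?_⟩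
  · exact Prod.Lex.monotone_fst (α := ℝ) (β := ℕ) _ _
      (φ.symm.monotone (Nat.sub_le_sub_right hij 1))
  · have e : {j : ℕ | 1 ≤ j ∧ (ofLex (φ.symm (j - 1)).1).1 = z}
        = range (fun i : Fin (m z) => φ (⟨toLex (z, i.1), i.2⟩ : P) + 1) := by
      ext j
      constructor
      · rintro ⟨hj, rfl⟩
        refine ⟨⟨(ofLex (φ.symm (j - 1)).1).2, (φ.symm (j - 1)).2⟩, ?_⟩
        have : φ (φ.symm (j - 1)) + 1 = j := by rw [φ.apply_symm_apply]; omega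
        exact this
      · rintro ⟨i, rfl⟩
        refine ⟨Nat.le_add_left 1 _, ?_⟩
        simp
    rw [e, ← image_univ, Function.Injective.encard_image]
    · simp
    · intro i j h
      have h1 : φ (⟨toLex (z, i.1), i.2⟩ : P) = φ (⟨toLex (z, j.1), j.2⟩ : P) :=
        Nat.succ_injective h
      have h2 := congrArg (fun p : P => (ofLex p.1).2) (φ.injective h1)
      exact Fin.ext h2

/-! ### The quadratic form of the operator and surjectivity of H + M -/

section

variable {a : ℝ} {V : ℝ → ℝ} {σ : ℂ}

theorem integrable_conj_mul {f g : ℝ → ℂ} (hf : MemLp f 2 (cellMeasure a))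
    (hg : MemLp g 2 (cellMeasure a)) : Integrable (fun x => conj (f x) * g x) (cellMeasure a) :=
  hf.star.integrable_mul hg

theorem memLp_potential_mul (hV : MemLp V ⊤ (cellMeasure a)) {f : ℝ → ℂ}
    (hf : MemLp f 2 (cellMeasure a)) : MemLp (fun x => (V x : ℂ) * f x) 2 (cellMeasure a) :=
  hf.mul (p := ⊤) (hV.ofReal (K := ℂ))

theorem exists_potential_bound (hV : MemLp V ⊤ (cellMeasure a)) :
    ∃ C : ℝ, 0 ≤ C ∧ ∀ᵐ x ∂(cellMeasure a), |V x| ≤ C := by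
  refine ⟨(eLpNormEssSup V (cellMeasure a)).toReal, ENNReal.toReal_nonneg, ?_⟩
  have h : eLpNormEssSup V (cellMeasure a) ≠ ⊤ := by
    have := hV.2
    rw [eLpNorm_exponent_top] at this
    exact this.ne
  filter_upwards [ae_le_eLpNormEssSup (f := V) (μ := cellMeasure a)] with x hx
  have := ENNReal.toReal_mono h hx
  simpa using this

theorem mem_opGraph_iff {F G : L2 a} : (F, G) ∈ opGraph a V σ ↔ ∃ u v w : ℝ → ℂ,
    InDomain a σ u v w ∧ F =ᵐ[cellMeasure a] u ∧
    G =ᵐ[cellMeasure a] fun x => -w x + (V x : ℂ) * u x := by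
  constructor
  · rintro ⟨u, v, w, h, h1, h2, h3, h4⟩
    exact ⟨u, v, w, ⟨h, h1, h2⟩, h3, h4⟩
  · rintro ⟨u, v, w, ⟨h, h1, h2⟩, h3, h4⟩
    exact ⟨u, v, w, h, h1, h2, h3, h4⟩

theorem inner_eq_integral {F G : L2 a} {f g : ℝ → ℂ} (hF : F =ᵐ[cellMeasure a] f)
    (hG : G =ᵐ[cellMeasure a] g) : inner ℂ F G = ∫ x, conj (f x) * g x ∂(cellMeasure a) := by
  rw [L2.inner_def]
  refine integral_congr_ae ?_
  filter_upwards [hF, hG] with x h1 h2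
  rw [h1, h2, RCLike.inner_apply, mul_comm]

theorem norm_sq_eq_integral {F : L2 a} {f : ℝ → ℂ} (hF : F =ᵐ[cellMeasure a] f) :
    ‖F‖ ^ 2 = ∫ x, ‖f x‖ ^ 2 ∂(cellMeasure a) := by
  have h := inner_eq_integral hF hF
  have h2 := inner_self_eq_norm_sq_to_K (𝕜 := ℂ) F
  rw [h] at h2
  have h3 : ∫ x, conj (f x) * f x ∂(cellMeasure a)
      = ((∫ x, ‖f x‖ ^ 2 ∂(cellMeasure a) : ℝ) : ℂ) := by
    rw [← integral_complex_ofReal]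
    refine integral_congr_ae (.of_forall fun x => ?_)
    simp only [Complex.conj_mul']
    push_cast; rfl
  rw [h3] at h2
  refine Complex.ofReal_injective (Eq.trans ?_ h2.symm)
  push_cast; rfl

/-- The sesquilinear form of the operator on its domain. -/
theorem inner_graph (ha : 0 < a) (hσ : conj σ * σ = 1) (hV : MemLp V ⊤ (cellMeasure a))
    {u v w f f' : ℝ → ℂ} (h : InDomain a σ u v w) (hf : IsFormFunction a σ f f')
    {F G Φ : L2 a} (hF : F =ᵐ[cellMeasure a] u)
    (hG : G =ᵐ[cellMeasure a] fun x => -w x + (V x : ℂ) * u x) (hΦ : Φ =ᵐ[cellMeasure a] f)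
    (M : ℝ) :
    inner ℂ (G + (M : ℂ) • F) Φ = ∫ x, (conj (v x) * f' x
      + ((V x + M : ℝ) : ℂ) * (conj (u x) * f x)) ∂(cellMeasure a) := by
  have mf := memLp_of_continuousOn hf.continuousOn
  have mu := memLp_of_continuousOn h.isH2.continuousOn_u
  have mv := memLp_of_continuousOn h.isH2.continuousOn_v
  have hG' : (G + (M : ℂ) • F : L2 a) =ᵐ[cellMeasure a]
      fun x => -w x + (((V x : ℂ) * u x) + (M : ℂ) * u x) := by
    filter_upwards [hF, hG, Lp.coeFn_add G ((M : ℂ) • F), Lp.coeFn_smul (M : ℂ) F]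
      with x h1 h2 h3 h4
    rw [h3, Pi.add_apply, h4, Pi.smul_apply, h1, h2, smul_eq_mul]; ring
  rw [inner_eq_integral hG' hΦ]
  have i1 := integrable_conj_mul h.isH2.memLp mf
  have i2 := integrable_conj_mul mv hf.memLp
  have mq : MemLp (fun x => (V x : ℂ) * u x + (M : ℂ) * u x) 2 (cellMeasure a) :=
    (memLp_potential_mul hV mu).add (mu.const_mul (M : ℂ))
  have i3 := integrable_conj_mul mq mf
  have e1 : ∀ x, conj (-w x + ((V x : ℂ) * u x + (M : ℂ) * u x)) * f x
      = -(conj (w x) * f x) + conj ((V x : ℂ) * u x + (M : ℂ) * u x) * f x := fun x => by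
    simp only [map_add, map_neg]; ring
  have e2 : ∀ x, conj (v x) * f' x + ((V x + M : ℝ) : ℂ) * (conj (u x) * f x)
      = conj (v x) * f' x + conj ((V x : ℂ) * u x + (M : ℂ) * u x) * f x := fun x => by
    simp only [map_add, map_mul, Complex.conj_ofReal]; push_cast; ring
  simp only [e1, e2]
  rw [integral_add i1.fun_neg i3, integral_add i2 i3, integral_neg, h.integral_conj_mul ha hσ hf,
    neg_neg]

/-- Symmetry of the operator. -/
theorem inner_opGraph_symm (ha : 0 < a) (hσ : conj σ * σ = 1) (hV : MemLp V ⊤ (cellMeasure a))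
    {F G F₁ G₁ : L2 a} (h : (F, G) ∈ opGraph a V σ) (h₁ : (F₁, G₁) ∈ opGraph a V σ) :
    inner ℂ G F₁ = inner ℂ F G₁ := by
  obtain ⟨u, v, w, hd, hF, hG⟩ := mem_opGraph_iff.1 h
  obtain ⟨u₁, v₁, w₁, hd₁, hF₁, hG₁⟩ := mem_opGraph_iff.1 h₁
  have e1 := inner_graph ha hσ hV hd hd₁.isFormFunction hF hG hF₁ 0
  have e2 := inner_graph ha hσ hV hd₁ hd.isFormFunction hF₁ hG₁ hF 0
  simp only [Complex.ofReal_zero, zero_smul, add_zero] at e1 e2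
  rw [← inner_conj_symm F G₁, e1, e2, ← integral_conj]
  refine integral_congr_ae (.of_forall fun x => ?_)
  simp only [map_add, map_mul, Complex.conj_conj, Complex.conj_ofReal]; ring

/-- The quadratic form of the operator shifted by `M`. -/
def energy (a : ℝ) (V : ℝ → ℝ) (M : ℝ) (f f' : ℝ → ℂ) : ℝ :=
  ∫ x, (‖f' x‖ ^ 2 + (V x + M) * ‖f x‖ ^ 2) ∂(cellMeasure a)

theorem integrable_norm_sq {f : ℝ → ℂ} (hf : MemLp f 2 (cellMeasure a)) :
    Integrable (fun x => ‖f x‖ ^ 2) (cellMeasure a) :=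
  (memLp_two_iff_integrable_sq_norm hf.1).1 hf

theorem integrable_potential_mul_norm_sq (hV : MemLp V ⊤ (cellMeasure a)) {f : ℝ → ℂ}
    (hf : MemLp f 2 (cellMeasure a)) (M : ℝ) :
    Integrable (fun x => (V x + M) * ‖f x‖ ^ 2) (cellMeasure a) := by
  have h1 := (integrable_conj_mul hf (memLp_potential_mul hV hf)).re
  refine (h1.add ((integrable_norm_sq hf).const_mul M)).congr (.of_forall fun x => ?_)
  have : conj (f x) * ((V x : ℂ) * f x) = ((V x * ‖f x‖ ^ 2 : ℝ) : ℂ) := by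
    rw [mul_left_comm, Complex.conj_mul']; push_cast; rfl
  simp only [Pi.add_apply]
  rw [this, RCLike.re_eq_complex_re, Complex.ofReal_re]
  ring

theorem re_inner_eq_energy (ha : 0 < a) (hσ : conj σ * σ = 1) (hV : MemLp V ⊤ (cellMeasure a))
    {u v w : ℝ → ℂ} (h : InDomain a σ u v w)
    {F G : L2 a} (hF : F =ᵐ[cellMeasure a] u)
    (hG : G =ᵐ[cellMeasure a] fun x => -w x + (V x : ℂ) * u x) (M : ℝ) :
    (inner ℂ (G + (M : ℂ) • F) F).re = energy a V M u v := by
  rw [inner_graph ha hσ hV h h.isFormFunction hF hG hF M, energy]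
  rw [← Complex.ofReal_re (∫ x, _ ∂_), ← integral_complex_ofReal]
  congr 1
  refine integral_congr_ae (.of_forall fun x => ?_)
  simp only [Complex.conj_mul']
  push_cast; rfl

/-- The shift gives V + M ≥ 1 almost everywhere, so the form dominates the squared H¹ norm. -/
theorem norm_sq_add_le_energy {M C : ℝ} (hV : MemLp V ⊤ (cellMeasure a))
    (hC : ∀ᵐ x ∂(cellMeasure a), |V x| ≤ C) (hM : C + 1 ≤ M) {f f' : ℝ → ℂ}
    (hf : MemLp f 2 (cellMeasure a)) (hf' : MemLp f' 2 (cellMeasure a)) :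
    ∫ x, ‖f' x‖ ^ 2 ∂(cellMeasure a) + ∫ x, ‖f x‖ ^ 2 ∂(cellMeasure a) ≤ energy a V M f f' := by
  rw [energy, ← integral_add (integrable_norm_sq hf') (integrable_norm_sq hf)]
  refine integral_mono_ae ((integrable_norm_sq hf').add (integrable_norm_sq hf))
    ((integrable_norm_sq hf').add (integrable_potential_mul_norm_sq hV hf M)) ?_
  filter_upwards [hC] with x hx
  have := (abs_le.1 hx).1
  have h2 : 1 ≤ V x + M := by linarith
  nlinarith [sq_nonneg ‖f x‖]

/-- Multiplication by the potential, as a bounded operator. -/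
theorem exists_multiplication (hV : MemLp V ⊤ (cellMeasure a)) {C : ℝ} (hC0 : 0 ≤ C)
    (hC : ∀ᵐ x ∂(cellMeasure a), |V x| ≤ C) :
    ∃ B : L2 a →L[ℂ] L2 a, ‖B‖ ≤ C ∧
      ∀ F : L2 a, B F =ᵐ[cellMeasure a] fun x => (V x : ℂ) * F x := by
  have hm (F : L2 a) := memLp_potential_mul hV (Lp.memLp F)
  let B₀ : L2 a →ₗ[ℂ] L2 a :=
    { toFun := fun F => (hm F).toLp
      map_add' := fun F G => by
        refine Lp.ext ?_
        filter_upwards [(hm (F + G)).coeFn_toLp, Lp.coeFn_add F G,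
          Lp.coeFn_add (hm F).toLp (hm G).toLp, (hm F).coeFn_toLp, (hm G).coeFn_toLp]
          with x h1 h2 h3 h4 h5
        rw [h1, h2, h3, Pi.add_apply, Pi.add_apply, h4, h5]; ring
      map_smul' := fun c F => by
        refine Lp.ext ?_
        filter_upwards [(hm (c • F)).coeFn_toLp, Lp.coeFn_smul c F,
          Lp.coeFn_smul c (hm F).toLp, (hm F).coeFn_toLp] with x h1 h2 h3 h4
        rw [h1, h2, RingHom.id_apply, h3, Pi.smul_apply, Pi.smul_apply, h4, smul_eq_mul,
          smul_eq_mul]; ring }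
  refine ⟨B₀.mkContinuous C fun F => ?_, LinearMap.mkContinuous_norm_le _ hC0 _,
    fun F => (hm F).coeFn_toLp⟩
  refine Lp.norm_le_mul_norm_of_ae_le_mul ?_
  filter_upwards [(hm F).coeFn_toLp, hC] with x h1 h2
  have h3 : (B₀ F : ℝ → ℂ) x = (V x : ℂ) * F x := h1
  rw [h3, norm_mul, Complex.norm_real]
  gcongr
  exact h2

/-- The relation `(f, (H + M) f)` for the operator `H` with graph `G`. -/
def shiftGraph (G : Submodule ℂ (L2 a × L2 a)) (M : ℝ) : Submodule ℂ (L2 a × L2 a) :=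
  G.comap (LinearMap.prod (LinearMap.fst ℂ _ _)
    (LinearMap.snd ℂ _ _ - (M : ℂ) • LinearMap.fst ℂ _ _))

theorem mem_shiftGraph {G : Submodule ℂ (L2 a × L2 a)} {M : ℝ} {f g : L2 a} :
    (f, g) ∈ shiftGraph G M ↔ (f, g - (M : ℂ) • f) ∈ G := Iff.rfl

theorem exists_mem_opGraph_zero (ha : 0 < a) (hσ : conj σ * σ = 1) {M : ℝ} (hM : 0 < M)
    (g : L2 a) : ∃ f : L2 a, (f, g - (M : ℂ) • f) ∈ opGraph a 0 σ := by
  obtain ⟨u, v, w, hd, hu⟩ := exists_inDomain ha hσ (Real.sqrt_ne_zero'.2 hM) (Lp.memLp g)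
  have mu := memLp_of_continuousOn hd.isH2.continuousOn_u
  refine ⟨mu.toLp, mem_opGraph_iff.2 ⟨u, v, w, hd, mu.coeFn_toLp, ?_⟩⟩
  filter_upwards [Lp.coeFn_sub g ((M : ℂ) • mu.toLp), Lp.coeFn_smul (M : ℂ) mu.toLp,
    mu.coeFn_toLp] with x h1 h2 h3
  rw [h1, Pi.sub_apply, h2, Pi.smul_apply, h3, ← hu x, Real.sq_sqrt hM.le]
  simp

theorem mul_norm_le_of_mem_opGraph_zero (ha : 0 < a) (hσ : conj σ * σ = 1) {M : ℝ}
    {f g : L2 a} (h : (f, g - (M : ℂ) • f) ∈ opGraph a 0 σ) : M * ‖f‖ ≤ ‖g‖ := by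
  obtain ⟨u, v, w, hd, hF, hG⟩ := mem_opGraph_iff.1 h
  have e := re_inner_eq_energy ha hσ MemLp.zero hd hF hG M
  rw [sub_add_cancel] at e
  have mu := memLp_of_continuousOn hd.isH2.continuousOn_u
  have mv := memLp_of_continuousOn hd.isH2.continuousOn_v
  have h1 : M * ‖f‖ ^ 2 ≤ energy a 0 M u v := by
    rw [norm_sq_eq_integral hF, energy, ← integral_const_mul]
    refine integral_mono ((integrable_norm_sq mu).const_mul M)
      ((integrable_norm_sq mv).add (integrable_potential_mul_norm_sq MemLp.zero mu M))
      fun x => ?_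
    simp only [Pi.zero_apply, zero_add]
    nlinarith [sq_nonneg ‖v x‖]
  have h2 : (inner ℂ g f).re ≤ ‖g‖ * ‖f‖ :=
    (Complex.re_le_norm _).trans (norm_inner_le_norm g f)
  rcases (norm_nonneg f).eq_or_lt with h0 | h0
  · rw [← h0]; simp
  · nlinarith

/-- `H + M` is onto for large `M`. -/
theorem exists_mem_opGraph (ha : 0 < a) (hσ : conj σ * σ = 1) (hV : MemLp V ⊤ (cellMeasure a))
    {C M : ℝ} (hC0 : 0 ≤ C) (hC : ∀ᵐ x ∂(cellMeasure a), |V x| ≤ C) (hM : C < M) (g : L2 a) :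
    ∃ f : L2 a, (f, g - (M : ℂ) • f) ∈ opGraph a V σ := by
  have hM0 : 0 < M := hC0.trans_lt hM
  obtain ⟨T, hT, hTn⟩ := exists_resolvent (shiftGraph (opGraph a 0 σ) M) hM0
    (fun f g h => mul_norm_le_of_mem_opGraph_zero ha hσ h)
    (fun g => exists_mem_opGraph_zero ha hσ hM0 g)
  obtain ⟨B, hBn, hB⟩ := exists_multiplication hV hC0 hC
  -- With T the resolvent for V = 0, (H + M)f = g reads f = T(g - Vf), and ‖T‖‖B‖ ≤ C/M < 1.
  obtain ⟨f, hf⟩ := exists_eq_apply_sub T B (by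
    calc ‖T‖ * ‖B‖ ≤ M⁻¹ * C := by gcongr
      _ < M⁻¹ * M := by gcongr
      _ = 1 := inv_mul_cancel₀ hM0.ne') g
  refine ⟨f, ?_⟩
  obtain ⟨u, v, w, hd, hF, hG⟩ := mem_opGraph_iff.1 (mem_shiftGraph.1 ((hT _ _).2 hf))
  refine mem_opGraph_iff.2 ⟨u, v, w, hd, hF, ?_⟩
  filter_upwards [hF, hG, hB f, Lp.coeFn_sub (g - B f) ((M : ℂ) • f), Lp.coeFn_sub g (B f),
    Lp.coeFn_sub g ((M : ℂ) • f)] with x h1 h2 h3 h4 h5 h6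
  rw [h4, Pi.sub_apply, h5, Pi.sub_apply, h3, h1] at h2
  rw [h6, Pi.sub_apply]
  simp only [Pi.zero_apply, Complex.ofReal_zero, zero_mul, add_zero] at h2
  linear_combination h2

end

/-! ### Poincaré inequality and the compact resolvent -/

section

variable {a : ℝ} {V : ℝ → ℝ} {σ : ℂ}

/-- Cauchy-Schwarz against the constant function. -/
theorem sq_integral_le {p q : ℝ} (hpq : p < q) {g : ℝ → ℝ} (hg : ContinuousOn g (Icc p q)) :
    (∫ x in p..q, g x) ^ 2 ≤ (q - p) * ∫ x in p..q, g x ^ 2 := by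
  have hg' : ContinuousOn g (uIcc p q) := by rwa [uIcc_of_le hpq.le]
  set I := ∫ x in p..q, g x with hI
  have hL : 0 < q - p := sub_pos.2 hpq
  have h0 : 0 ≤ ∫ x in p..q, (g x - I / (q - p)) ^ 2 :=
    intervalIntegral.integral_nonneg hpq.le fun x _ => sq_nonneg _
  have e : ∫ x in p..q, (g x - I / (q - p)) ^ 2
      = (∫ x in p..q, g x ^ 2) - 2 * (I / (q - p)) * I + (q - p) * (I / (q - p)) ^ 2 := by
    have e1 : ∀ x, (g x - I / (q - p)) ^ 2
        = g x ^ 2 - 2 * (I / (q - p)) * g x + (I / (q - p)) ^ 2 := fun x => by ring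
    simp only [e1]
    rw [intervalIntegral.integral_add, intervalIntegral.integral_sub,
      intervalIntegral.integral_const_mul, intervalIntegral.integral_const, smul_eq_mul]
    · exact (hg'.pow 2).intervalIntegrable
    · exact (continuousOn_const.mul hg').intervalIntegrable
    · exact ((hg'.pow 2).sub (continuousOn_const.mul hg')).intervalIntegrable
    · exact intervalIntegrable_const
  rw [e] at h0
  have e2 : (q - p) * ((∫ x in p..q, g x ^ 2) - 2 * (I / (q - p)) * I
      + (q - p) * (I / (q - p)) ^ 2) = (q - p) * (∫ x in p..q, g x ^ 2) - I ^ 2 := by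
    field_simp; ring
  have := mul_nonneg hL.le h0
  rw [e2] at this
  linarith

/-- Poincaré inequality for functions of mean zero. -/
theorem poincare {p q : ℝ} (hpq : p < q) {u v : ℝ → ℂ} (hu : ContinuousOn u (Icc p q))
    (hv : ContinuousOn v (Icc p q)) (huv : ∀ x ∈ Icc p q, u x = u p + ∫ t in p..x, v t)
    (h0 : ∫ x in p..q, u x = 0) :
    ∫ x in p..q, ‖u x‖ ^ 2 ≤ (q - p) ^ 2 * ∫ x in p..q, ‖v x‖ ^ 2 := by
  have hL : 0 < q - p := sub_pos.2 hpq
  have hu' : ContinuousOn u (uIcc p q) := by rwa [uIcc_of_le hpq.le]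
  have hv' : ContinuousOn v (uIcc p q) := by rwa [uIcc_of_le hpq.le]
  set I := ∫ t in p..q, ‖v t‖ with hI
  have hsub : ∀ x ∈ Icc p q, uIcc p x ⊆ uIcc p q := fun x hx => by
    rw [uIcc_of_le hpq.le, uIcc_of_le hx.1]; exact Icc_subset_Icc_right hx.2
  have hdiff : ∀ x ∈ Icc p q, ∀ y ∈ Icc p q, ‖u x - u y‖ ≤ I := by
    intro x hx y hy
    have e : u x - u y = ∫ t in y..x, v t := by
      rw [huv x hx, huv y hy, add_sub_add_left_eq_sub]
      exact intervalIntegral.integral_interval_sub_left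
        (hv'.mono (hsub x hx)).intervalIntegrable (hv'.mono (hsub y hy)).intervalIntegrable
    rw [e]
    refine intervalIntegral.norm_integral_le_integral_norm_uIoc.trans ?_
    rw [hI, intervalIntegral.integral_of_le hpq.le]
    refine setIntegral_mono_set ?_ (.of_forall fun t => norm_nonneg _) ?_
    · exact (hv'.norm.intervalIntegrable (μ := volume)).1
    · refine LE.le.eventuallyLE ?_
      intro t ht
      rw [mem_uIoc] at ht
      rcases ht with ht | ht
      · exact ⟨hy.1.trans_lt ht.1, ht.2.trans hx.2⟩
      · exact ⟨hx.1.trans_lt ht.1, ht.2.trans hy.2⟩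
  have hbd : ∀ x ∈ Icc p q, ‖u x‖ ≤ I := by
    intro x hx
    -- As u has mean zero, u(x) is the average of u(x) - u(y) over y, so it inherits the bound on
    -- differences.
    have e : ∫ y in p..q, (u x - u y) = ((q - p : ℝ) : ℂ) * u x := by
      rw [intervalIntegral.integral_sub intervalIntegrable_const hu'.intervalIntegrable, h0,
        intervalIntegral.integral_const, sub_zero, Complex.real_smul]
    have h1 : ‖∫ y in p..q, (u x - u y)‖ ≤ I * |q - p| := by
      refine intervalIntegral.norm_integral_le_of_norm_le_const fun y hy => ?_
      rw [uIoc_of_le hpq.le] at hy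
      exact hdiff x hx y (Ioc_subset_Icc_self hy)
    rw [e, norm_mul, Complex.norm_real, Real.norm_eq_abs, mul_comm] at h1
    exact le_of_mul_le_mul_right h1 (abs_pos.2 hL.ne')
  have hcs := sq_integral_le hpq hv.norm
  calc ∫ x in p..q, ‖u x‖ ^ 2 ≤ ∫ x in p..q, I ^ 2 := by
        refine intervalIntegral.integral_mono_on hpq.le (hu'.norm.pow 2).intervalIntegrable
          intervalIntegrable_const fun x hx => ?_
        exact pow_le_pow_left₀ (norm_nonneg _) (hbd x hx) 2
    _ = (q - p) * I ^ 2 := by rw [intervalIntegral.integral_const, smul_eq_mul]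
    _ ≤ (q - p) * ((q - p) * ∫ x in p..q, ‖v x‖ ^ 2) := by gcongr
    _ = _ := by ring

theorem IsH2.eq_u_of_le {u v w : ℝ → ℂ} (h : IsH2 a u v w) {p x : ℝ}
    (hp : p ∈ Icc (-a / 2) (a / 2)) (hx : x ∈ Icc (-a / 2) (a / 2)) :
    u x = u p + ∫ t in p..x, v t := by
  have := intervalIntegral.integral_interval_sub_left (h.intervalIntegrable_v hx)
    (h.intervalIntegrable_v hp)
  rw [h.eq_u x hx, h.eq_u p hp, ← this]; ring

/-- Poincaré inequality on a partition into `N` cells of equal length. -/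
theorem IsH2.poincare_partition (ha : 0 < a) {u v w : ℝ → ℂ} (h : IsH2 a u v w) {N : ℕ}
    (hN : 0 < N) (h0 : ∀ k < N, ∫ x in (-a / 2 + k * (a / N))..(-a / 2 + (k + 1 : ℕ) * (a / N)),
      u x = 0) :
    ∫ x, ‖u x‖ ^ 2 ∂(cellMeasure a) ≤ (a / N) ^ 2 * ∫ x, ‖v x‖ ^ 2 ∂(cellMeasure a) := by
  have hN' : (0 : ℝ) < N := by exact_mod_cast hN
  set s : ℕ → ℝ := fun k => -a / 2 + k * (a / N) with hs
  have hs0 : s 0 = -a / 2 := by simp [hs]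
  have hsN : s N = a / 2 := by simp only [hs]; field_simp; ring
  have hlt : ∀ k, s k < s (k + 1) := fun k => by
    simp only [hs]; push_cast
    have : 0 < a / N := by positivity
    nlinarith
  have hmono : StrictMono s := strictMono_nat_of_lt_succ hlt
  have hmem : ∀ k ≤ N, s k ∈ Icc (-a / 2) (a / 2) := fun k hk => by
    rw [← hs0, ← hsN]; exact ⟨hmono.monotone (Nat.zero_le k), hmono.monotone hk⟩
  have hsub : ∀ k < N, Icc (s k) (s (k + 1)) ⊆ Icc (-a / 2) (a / 2) := fun k hk =>
    Icc_subset_Icc (hmem k hk.le).1 (hmem (k + 1) hk).2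
  have hint : ∀ g : ℝ → ℂ, ContinuousOn g (Icc (-a / 2) (a / 2)) → ∀ k < N,
      IntervalIntegrable (fun x => ‖g x‖ ^ 2) volume (s k) (s (k + 1)) := fun g hg k hk => by
    refine ((hg.mono ?_).norm.pow 2).intervalIntegrable
    rw [uIcc_of_le (hlt k).le]; exact hsub k hk
  rw [integral_cellMeasure ha, integral_cellMeasure ha, ← hs0, ← hsN,
    ← intervalIntegral.sum_integral_adjacent_intervals (hint u h.continuousOn_u),
    ← intervalIntegral.sum_integral_adjacent_intervals (hint v h.continuousOn_v), Finset.mul_sum]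
  refine Finset.sum_le_sum fun k hk => ?_
  rw [Finset.mem_range] at hk
  have hlen : s (k + 1) - s k = a / N := by simp only [hs]; push_cast; ring
  have := poincare (hlt k) (h.continuousOn_u.mono (hsub k hk)) (h.continuousOn_v.mono (hsub k hk))
    (fun x hx => h.eq_u_of_le (hmem k hk.le) (hsub k hk hx)) (h0 k hk)
  rwa [hlen] at this

/-- `T` is the resolvent `(H + M)⁻¹` of the operator with graph `opGraph a V σ`, with the properties
used below. -/
structure IsResolvent (a : ℝ) (V : ℝ → ℝ) (σ : ℂ) (M : ℝ) (T : L2 a →L[ℂ] L2 a) : Prop where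
  mem_iff : ∀ f g, (f, g) ∈ opGraph a V σ ↔ f = T (g + (M : ℂ) • f)
  symm : (T : L2 a →ₗ[ℂ] L2 a).IsSymmetric
  norm_sq_le : ∀ f g, (f, g) ∈ opGraph a V σ → ‖f‖ ^ 2 ≤ (inner ℂ (g + (M : ℂ) • f) f).re
  small : SmallOnFiniteCodim T

theorem IsResolvent.apply_mem {M : ℝ} {T : L2 a →L[ℂ] L2 a} (hT : IsResolvent a V σ M T)
    (g : L2 a) : (T g, g - (M : ℂ) • T g) ∈ opGraph a V σ := by
  rw [hT.mem_iff, sub_add_cancel]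

/-- Coercivity of the shifted form gives ‖Tg‖ ≤ ‖g‖ and ‖(Tg)'‖ ≤ ‖g‖. If Tg has mean zero on each
of `N` equal cells, Poincaré yields ‖Tg‖ ≤ (a/N)‖g‖, which is the smallness that makes `T` compact.
-/
theorem exists_isResolvent (ha : 0 < a) (hσ : conj σ * σ = 1) (hV : MemLp V ⊤ (cellMeasure a))
    {C M : ℝ} (hC0 : 0 ≤ C) (hC : ∀ᵐ x ∂(cellMeasure a), |V x| ≤ C) (hM : C + 1 ≤ M) :
    ∃ T, IsResolvent a V σ M T := by
  have henergy : ∀ F G : L2 a, (F, G) ∈ opGraph a V σ → ∃ u v w : ℝ → ℂ, IsH2 a u v w ∧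
      F =ᵐ[cellMeasure a] u ∧
      ∫ x, ‖v x‖ ^ 2 ∂(cellMeasure a) + ‖F‖ ^ 2 ≤ (inner ℂ (G + (M : ℂ) • F) F).re := by
    intro F G h
    obtain ⟨u, v, w, hd, hF, hG⟩ := mem_opGraph_iff.1 h
    refine ⟨u, v, w, hd.isH2, hF, ?_⟩
    rw [re_inner_eq_energy ha hσ hV hd hF hG M, norm_sq_eq_integral hF]
    exact norm_sq_add_le_energy hV hC hM (memLp_of_continuousOn hd.isH2.continuousOn_u)
      (memLp_of_continuousOn hd.isH2.continuousOn_v)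
  have hlow : ∀ F G : L2 a, (F, G) ∈ opGraph a V σ →
      ‖F‖ ^ 2 ≤ (inner ℂ (G + (M : ℂ) • F) F).re := by
    intro F G h
    obtain ⟨u, v, w, -, -, h1⟩ := henergy F G h
    have : 0 ≤ ∫ x, ‖v x‖ ^ 2 ∂(cellMeasure a) := integral_nonneg fun x => by positivity
    linarith
  have hnorm : ∀ f g : L2 a, (f, g - (M : ℂ) • f) ∈ opGraph a V σ → ‖f‖ ≤ ‖g‖ := by
    intro f g h
    have h1 := hlow _ _ h
    rw [sub_add_cancel] at h1
    have h2 : (inner ℂ g f).re ≤ ‖g‖ * ‖f‖ :=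
      (Complex.re_le_norm _).trans (norm_inner_le_norm g f)
    rcases (norm_nonneg f).eq_or_lt with h0 | h0
    · rw [← h0]; exact norm_nonneg g
    · nlinarith
  obtain ⟨T, hT, -⟩ := exists_resolvent (shiftGraph (opGraph a V σ) M) one_pos
    (fun f g h => by rw [one_mul]; exact hnorm f g h)
    (fun g => exists_mem_opGraph ha hσ hV hC0 hC (by linarith) g)
  have hmem : ∀ g, (T g, g - (M : ℂ) • T g) ∈ opGraph a V σ := fun g =>
    mem_shiftGraph.1 ((hT _ _).2 rfl)
  have hsymm : (T : L2 a →ₗ[ℂ] L2 a).IsSymmetric := by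
    intro f g
    have := inner_opGraph_symm ha hσ hV (hmem f) (hmem g)
    rw [inner_sub_left, inner_sub_right, inner_smul_left, inner_smul_right,
      Complex.conj_ofReal] at this
    exact (sub_left_inj.1 this).symm
  refine ⟨T, fun f g => ?_, hsymm, hlow, fun ε hε => ?_⟩
  · rw [← hT, mem_shiftGraph, add_sub_cancel_right]
  · obtain ⟨N, hN⟩ := exists_nat_gt (a / ε)
    have hN' : (0 : ℝ) < N := (by positivity : (0 : ℝ) < a / ε).trans hN
    have hN0 : 0 < N := by exact_mod_cast hN'
    have haN : a / N < ε := by rw [div_lt_iff₀ hN']; rw [div_lt_iff₀ hε] at hN; linarith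
    -- By symmetry, g orthogonal to T applied to the indicator of a cell means that Tg has mean zero
    -- on that cell.
    refine ⟨N, fun k => T (indicatorConstLp 2 (measurableSet_Ioo
      (a := -a / 2 + k * (a / N)) (b := -a / 2 + (k + 1 : ℕ) * (a / N)))
      (measure_ne_top (cellMeasure a) _) 1), fun g hg => ?_⟩
    obtain ⟨u, v, w, h2, hu, he⟩ := henergy _ _ (hmem g)
    rw [sub_add_cancel] at he
    have hle : (inner ℂ g (T g)).re ≤ ‖g‖ ^ 2 := by
      have := (Complex.re_le_norm _).trans (norm_inner_le_norm (𝕜 := ℂ) g (T g))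
      nlinarith [hnorm _ _ (hmem g), norm_nonneg g]
    have hp := h2.poincare_partition ha hN0 fun k hk => by
      have h3 := hg ⟨k, hk⟩
      have h4 := hsymm (indicatorConstLp 2 (measurableSet_Ioo
        (a := -a / 2 + k * (a / N)) (b := -a / 2 + (k + 1 : ℕ) * (a / N)))
        (measure_ne_top (cellMeasure a) _) 1) g
      have h5 := h4.symm.trans h3
      rw [ContinuousLinearMap.coe_coe, L2.inner_indicatorConstLp_one] at h5
      have haN0 : 0 < a / N := by positivity
      have hk1 : ((k + 1 : ℕ) : ℝ) ≤ N := by exact_mod_cast hk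
      have hsub : Ioo (-a / 2 + k * (a / N)) (-a / 2 + (k + 1 : ℕ) * (a / N))
          ⊆ Ioo (-a / 2) (a / 2) := by
        refine Ioo_subset_Ioo ?_ ?_
        · have : (0 : ℝ) ≤ k * (a / N) := by positivity
          linarith
        · have : ((k + 1 : ℕ) : ℝ) * (a / N) ≤ N * (a / N) := by gcongr
          rw [mul_div_cancel₀ _ hN'.ne'] at this
          linarith
      rw [intervalIntegral.integral_of_le (by push_cast; nlinarith),
        integral_Ioc_eq_integral_Ioo, ← h5, Measure.restrict_restrict measurableSet_Ioo,
        inter_eq_self_of_subset_left hsub]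
      refine integral_congr_ae ?_
      have h7 : T g =ᵐ[volume.restrict (Ioo (-a / 2 + k * (a / N))
          (-a / 2 + (k + 1 : ℕ) * (a / N)))] u := ae_mono (Measure.restrict_mono_set volume hsub) hu
      exact h7.symm
    rw [← norm_sq_eq_integral hu] at hp
    have hv0 : ∫ x, ‖v x‖ ^ 2 ∂(cellMeasure a) ≤ ‖g‖ ^ 2 := by nlinarith [sq_nonneg ‖T g‖]
    have h6 : ‖T g‖ ^ 2 ≤ (ε * ‖g‖) ^ 2 := by
      rw [mul_pow]
      refine hp.trans ?_
      gcongr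
    exact (sq_le_sq₀ (norm_nonneg _) (by positivity)).1 h6

/-- Trial functions in the form domain give lower bounds for the quadratic form of the
resolvent. -/
theorem IsResolvent.norm_sq_le_of_energy_le (ha : 0 < a) (hσ : conj σ * σ = 1)
    (hV : MemLp V ⊤ (cellMeasure a)) {C M : ℝ} (hC : ∀ᵐ x ∂(cellMeasure a), |V x| ≤ C)
    (hM : C + 1 ≤ M) {T : L2 a →L[ℂ] L2 a} (hT : IsResolvent a V σ M T) {f f' : ℝ → ℂ}
    (hf : IsFormFunction a σ f f') {Φ : L2 a} (hΦ : Φ =ᵐ[cellMeasure a] f) {l : ℝ} (hl : 0 < l)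
    (he : energy a V M f f' ≤ l * ‖Φ‖ ^ 2) : ‖Φ‖ ^ 2 ≤ l * (inner ℂ (T Φ) Φ).re := by
  obtain ⟨u, v, w, hd, hF, hG⟩ := mem_opGraph_iff.1 (hT.apply_mem Φ)
  have e1 := inner_graph ha hσ hV hd hf hF hG hΦ M
  have e2 := re_inner_eq_energy ha hσ hV hd hF hG M
  rw [sub_add_cancel] at e1 e2
  have e2' : (inner ℂ (T Φ) Φ).re = energy a V M u v := by
    rw [← e2, ← inner_conj_symm, Complex.conj_re]
  have mf := memLp_of_continuousOn hf.continuousOn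
  have mu := memLp_of_continuousOn hd.isH2.continuousOn_u
  have mv := memLp_of_continuousOn hd.isH2.continuousOn_v
  have iB : Integrable (fun x => conj (v x) * f' x
      + ((V x + M : ℝ) : ℂ) * (conj (u x) * f x)) (cellMeasure a) := by
    have mq : MemLp (fun x => (V x : ℂ) * f x + (M : ℂ) * f x) 2 (cellMeasure a) :=
      (memLp_potential_mul hV mf).add (mf.const_mul (M : ℂ))
    refine ((integrable_conj_mul mv hf.memLp).add (integrable_conj_mul mu mq)).congr
      (.of_forall fun x => ?_)
    simp only [Pi.add_apply]; push_cast; ring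
  have e1' : ‖Φ‖ ^ 2 = ∫ x, (conj (v x) * f' x
      + ((V x + M : ℝ) : ℂ) * (conj (u x) * f x)).re ∂(cellMeasure a) := by
    have h1 : (∫ x, (conj (v x) * f' x
      + ((V x + M : ℝ) : ℂ) * (conj (u x) * f x)).re ∂(cellMeasure a)) = _ := integral_re iB
    rw [h1, ← e1, RCLike.re_eq_complex_re, ← inner_self_eq_norm_sq (𝕜 := ℂ) Φ]
    rfl
  have iE (g g' : ℝ → ℂ) (hg : MemLp g 2 (cellMeasure a)) (hg' : MemLp g' 2 (cellMeasure a)) :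
      Integrable (fun x => ‖g' x‖ ^ 2 + (V x + M) * ‖g x‖ ^ 2) (cellMeasure a) :=
    (integrable_norm_sq hg').add (integrable_potential_mul_norm_sq hV hg M)
  -- The form is nonnegative at f - l·Tf. Expanded, E(f) - 2l‖f‖² + l²⟨Tf, f⟩ ≥ 0, and E(f) ≤ l‖f‖²
  -- gives the claim.
  have hnn : 0 ≤ ∫ x, ((‖f' x‖ ^ 2 + (V x + M) * ‖f x‖ ^ 2) - 2 * l * (conj (v x) * f' x
      + ((V x + M : ℝ) : ℂ) * (conj (u x) * f x)).re
      + l ^ 2 * (‖v x‖ ^ 2 + (V x + M) * ‖u x‖ ^ 2)) ∂(cellMeasure a) := by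
    refine integral_nonneg_of_ae ?_
    filter_upwards [hC] with x hx
    have hVM : 0 ≤ V x + M := by linarith [(abs_le.1 hx).1]
    have key : (‖f' x‖ ^ 2 + (V x + M) * ‖f x‖ ^ 2) - 2 * l * (conj (v x) * f' x
        + ((V x + M : ℝ) : ℂ) * (conj (u x) * f x)).re
        + l ^ 2 * (‖v x‖ ^ 2 + (V x + M) * ‖u x‖ ^ 2)
        = ‖f' x - l * v x‖ ^ 2 + (V x + M) * ‖f x - l * u x‖ ^ 2 := by
      simp only [Complex.sq_norm, Complex.normSq_apply, Complex.add_re, Complex.mul_re,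
        Complex.mul_im, Complex.conj_re, Complex.conj_im, Complex.ofReal_re, Complex.ofReal_im,
        Complex.sub_re, Complex.sub_im]
      ring
    rw [Pi.zero_apply, key]
    positivity
  rw [integral_add, integral_sub, integral_const_mul, integral_const_mul, ← e1'] at hnn
  · change 0 ≤ energy a V M f f' - 2 * l * ‖Φ‖ ^ 2 + l ^ 2 * energy a V M u v at hnn
    rw [e2']
    have h3 : 0 ≤ l * (l * energy a V M u v - ‖Φ‖ ^ 2) := by nlinarith
    have := nonneg_of_mul_nonneg_right h3 hl
    linarith
  · exact iE f f' mf hf.memLp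
  · exact iB.re.const_mul _
  · exact (iE f f' mf hf.memLp).sub (iB.re.const_mul _)
  · exact (iE u v mu mv).const_mul _

end

/-! ### Eigenvalues through the resolvent and the min-max principle -/

section

variable {a : ℝ} {V : ℝ → ℝ} {σ : ℂ} {M : ℝ} {T : L2 a →L[ℂ] L2 a}

theorem mem_eigenspace_iff {z : ℂ} {f : L2 a} :
    f ∈ eigenspace a V σ z ↔ (f, z • f) ∈ opGraph a V σ := Iff.rfl

theorem IsResolvent.mem_eigenspace_iff (hT : IsResolvent a V σ M T) {z : ℂ} {f : L2 a} :
    f ∈ eigenspace a V σ z ↔ f = (z + M) • T f := by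
  rw [Hill.mem_eigenspace_iff, hT.mem_iff, ← add_smul, map_smul]

/-- The case z = -M is included: the eigenspace is then zero, so the value 0 of the inverse is
harmless. -/
theorem IsResolvent.apply_eq (hT : IsResolvent a V σ M T) {z : ℂ} {f : L2 a}
    (hf : f ∈ eigenspace a V σ z) : T f = (z + M)⁻¹ • f := by
  rw [hT.mem_eigenspace_iff] at hf
  by_cases h : z + M = 0
  · rw [h, zero_smul] at hf
    rw [hf]; simp
  · conv_rhs => rw [hf]
    rw [smul_smul, inv_mul_cancel₀ h, one_smul]

theorem IsResolvent.mem_eigenspace_of_apply_eq (hT : IsResolvent a V σ M T) {μ : ℂ} (hμ : μ ≠ 0)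
    {f : L2 a} (hf : T f = μ • f) : f ∈ eigenspace a V σ (μ⁻¹ - M) := by
  rw [hT.mem_eigenspace_iff, sub_add_cancel, hf, smul_smul, inv_mul_cancel₀ hμ, one_smul]

theorem IsResolvent.eigenvalue_real (hT : IsResolvent a V σ M T) {z : ℂ} {f : L2 a}
    (hf : f ∈ eigenspace a V σ z) (h0 : f ≠ 0) : ((z.re : ℝ) : ℂ) = z ∧ 1 ≤ z.re + M := by
  constructor
  · have hev : Module.End.HasEigenvalue (T : L2 a →ₗ[ℂ] L2 a) (z + M)⁻¹ :=
      Module.End.hasEigenvalue_of_hasEigenvector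
        ⟨Module.End.mem_eigenspace_iff.2 (hT.apply_eq hf), h0⟩
    have h1 := hT.symm.conj_eigenvalue_eq_self hev
    rw [map_inv₀, inv_inj, map_add, Complex.conj_ofReal, add_left_inj] at h1
    exact Complex.conj_eq_iff_re.1 h1
  · have h1 := hT.norm_sq_le _ _ hf
    have h2 : (z • f + (M : ℂ) • f) = (z + M) • f := (add_smul _ _ _).symm
    change ‖f‖ ^ 2 ≤ (inner ℂ (z • f + (M : ℂ) • f) f).re at h1
    rw [h2, inner_smul_left, inner_self_eq_norm_sq_to_K] at h1
    have h3 : ((conj (z + M)) * ((‖f‖ : ℝ) : ℂ) ^ 2).re = (z.re + M) * ‖f‖ ^ 2 := by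
      rw [← Complex.ofReal_pow, Complex.re_mul_ofReal]; simp
    change ‖f‖ ^ 2 ≤ ((conj (z + M)) * ((‖f‖ : ℝ) : ℂ) ^ 2).re at h1
    rw [h3] at h1
    have h4 : 0 < ‖f‖ ^ 2 := by have := norm_pos_iff.2 h0; positivity
    exact le_of_mul_le_mul_right (by linarith) h4

theorem IsResolvent.finiteDimensional (hT : IsResolvent a V σ M T) (z : ℂ) :
    FiniteDimensional ℂ (eigenspace a V σ z) := by
  by_cases h : z + M = 0
  · have : eigenspace a V σ z = ⊥ := by
      rw [eq_bot_iff]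
      intro f hf
      rw [hT.mem_eigenspace_iff, h, zero_smul] at hf
      exact hf
    rw [this]; infer_instance
  · have := ContinuousLinearMap.finite_dimensional_eigenspace hT.small.isCompactOperator
      (z + M)⁻¹ (inv_ne_zero h)
    exact Submodule.finiteDimensional_of_le
      (S₂ := Module.End.eigenspace (T : Module.End ℂ (L2 a)) (z + M)⁻¹)
      fun f hf => Module.End.mem_eigenspace_iff.2 (hT.apply_eq hf)

theorem IsResolvent.orthogonalFamily (hT : IsResolvent a V σ M T) :
    OrthogonalFamily ℂ (fun z : ℂ => eigenspace a V σ z)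
      fun z => (eigenspace a V σ z).subtypeₗᵢ := by
  intro z z' hz f g
  have hne : (z + M)⁻¹ ≠ (z' + M)⁻¹ := fun h => hz (add_right_cancel (inv_injective h))
  exact hT.symm.orthogonalFamily_eigenspaces hne
    ⟨f.1, Module.End.mem_eigenspace_iff.2 (hT.apply_eq f.2)⟩
    ⟨g.1, Module.End.mem_eigenspace_iff.2 (hT.apply_eq g.2)⟩

/-- Orthonormal eigenvectors for an eigenvalue sequence. -/
theorem IsResolvent.exists_eigenvectors (hT : IsResolvent a V σ M T) {ν : ℕ → ℝ}
    (hν : IsEigenvalueSequence a V σ ν) :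
    ∃ e : {j : ℕ // 1 ≤ j} → L2 a, Orthonormal ℂ e ∧
      (∀ j : {j : ℕ // 1 ≤ j}, e j ∈ eigenspace a V σ (ν j)) ∧
      ∀ (z : ℂ), ∀ g ∈ eigenspace a V σ z, ∀ f : L2 a,
        (∀ j : {j : ℕ // 1 ≤ j}, (ν j : ℂ) = z → inner ℂ (e j) f = 0) → inner ℂ g f = 0 := by
  have hfd := hν.finite
  let J : ℂ → Type := fun z => {j : ℕ // 1 ≤ j ∧ (ν j : ℂ) = z}
  have hJ : ∀ z, Nonempty (J z ≃ Fin (Module.finrank ℂ (eigenspace a V σ z))) := by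
    intro z
    have h := hν.count z
    have hfin : {j : ℕ | 1 ≤ j ∧ (ν j : ℂ) = z}.Finite := finite_of_encard_eq_coe h
    have : Finite (J z) := hfin.to_subtype
    refine ⟨Finite.equivFinOfCardEq ?_⟩
    change Nat.card {j : ℕ | 1 ≤ j ∧ (ν j : ℂ) = z} = _
    rw [Nat.card_coe_set_eq, ncard, h, ENat.toNat_natCast]
  have hJf : ∀ z, Finite (J z) := fun z => Finite.of_equiv _ (hJ z).some.symm
  have hJt : ∀ z, Fintype (J z) := fun z => Fintype.ofFinite _
  let ob : ∀ z, OrthonormalBasis (J z) ℂ (eigenspace a V σ z) := fun z =>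
    (stdOrthonormalBasis ℂ (eigenspace a V σ z)).reindex (hJ z).some.symm
  have hsig := hT.orthogonalFamily.orthonormal_sigma_orthonormal
    (v_family := fun z => ob z) fun z => (ob z).orthonormal
  refine ⟨fun j => ob (ν j) ⟨j, j.2, rfl⟩, ?_, fun j => (ob (ν j) _).2, ?_⟩
  · exact hsig.comp (fun j : {j : ℕ // 1 ≤ j} => (⟨(ν j : ℂ), ⟨j, j.2, rfl⟩⟩ : Σ z, J z))
      fun i j h => by
        have h1 : ∀ p q : (Σ z, J z), p = q → p.2.1 = q.2.1 := by rintro p _ rfl; rfl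
        exact Subtype.ext (h1 _ _ h)
  · intro z g hg f hf
    have hb : ∀ k : J z, inner ℂ ((ob z k : eigenspace a V σ z) : L2 a) f = 0 := by
      rintro ⟨k, hk, rfl⟩
      exact hf ⟨k, hk⟩ rfl
    have hs := (ob z).sum_repr ⟨g, hg⟩
    have hs' : g = ∑ k, ((ob z).repr ⟨g, hg⟩ k) • ((ob z k : eigenspace a V σ z) : L2 a) := by
      have := congrArg (Subtype.val) hs
      simpa using this.symm
    rw [hs', sum_inner]
    exact Finset.sum_eq_zero fun k _ => by rw [inner_smul_left, hb k, mul_zero]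

/-- Upper bound for the eigenvalues by a trial space. -/
theorem IsResolvent.eigenvalue_le (hT : IsResolvent a V σ M T) {ν : ℕ → ℝ}
    (hν : IsEigenvalueSequence a V σ ν) {F : Type*} [AddCommGroup F] [Module ℂ F]
    [FiniteDimensional ℂ F] (L : F →ₗ[ℂ] L2 a) (hL : ∀ s, L s = 0 → s = 0) {l : ℝ} (hl : 0 < l)
    (hF : 1 ≤ Module.finrank ℂ F) (hle : ∀ s, ‖L s‖ ^ 2 ≤ l * (inner ℂ (T (L s)) (L s)).re) :
    ν (Module.finrank ℂ F) + M ≤ l := by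
  set n := Module.finrank ℂ F with hn
  obtain ⟨e, he, hmem, hspan⟩ := hT.exists_eigenvectors hν
  by_contra hlt
  push Not at hlt
  -- A nonzero trial vector orthogonal to the first n - 1 eigenvectors. Eigenvalues of `T` above (ν
  -- n + M)⁻¹ come from eigenvalues of H below ν n, whose indices are smaller than n, so
  -- `rayleigh_le` applies.
  obtain ⟨s, hs0, hs⟩ := exists_ne_zero_orthogonal (F := F)
    (fun i : Fin (n - 1) => (innerₛₗ ℂ (e ⟨i + 1, by omega⟩)) ∘ₗ L) (by simp; omega)
  have hpos : 0 < ‖L s‖ ^ 2 := by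
    have := norm_pos_iff.2 fun h => hs0 (hL s h)
    positivity
  have hνl : 0 < ν n + M := hl.trans hlt
  have h1 := rayleigh_le hT.small.isCompactOperator hT.symm (t := (ν n + M)⁻¹)
    (inv_nonneg.2 hνl.le) (f := L s) fun μ hμ g hg => by
      have hμ0 : 0 < μ := (inv_pos.2 hνl).trans hμ
      have hg' := hT.mem_eigenspace_of_apply_eq (by exact_mod_cast hμ0.ne') hg
      refine hspan _ g hg' _ fun j hj => ?_
      have hj' : ν j = μ⁻¹ - M := by exact_mod_cast hj
      have hlt' : ν j < ν n := by
        have := inv_lt_of_inv_lt₀ hνl hμ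
        linarith
      have hjn : (j : ℕ) < n := by
        by_contra h
        push Not at h
        exact absurd (hν.mono n j hF h) (not_le.2 hlt')
      have := hs ⟨j - 1, by have := j.2; omega⟩
      rw [LinearMap.comp_apply, innerₛₗ_apply_apply] at this
      have hj1 : (⟨(j : ℕ) - 1 + 1, by omega⟩ : {j : ℕ // 1 ≤ j}) = j :=
        Subtype.ext (Nat.sub_add_cancel j.2)
      simpa only [hj1] using this
  have h2 := hle s
  have h3 : l * (inner ℂ (T (L s)) (L s)).re ≤ l * ((ν n + M)⁻¹ * ‖L s‖ ^ 2) := by gcongr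
  have h4 : l * (ν n + M)⁻¹ < 1 := by
    rw [← div_eq_mul_inv, div_lt_one hνl]; exact hlt
  nlinarith

theorem coeFn_sum_smul {ι : Type*} (s : Finset ι) (c : ι → ℂ) (F : ι → L2 a) :
    ((∑ i ∈ s, c i • F i : L2 a) : ℝ → ℂ) =ᵐ[cellMeasure a] fun x => ∑ i ∈ s, c i * F i x := by
  classical
  induction s using Finset.induction_on with
  | empty =>
    simp only [Finset.sum_empty]
    exact Lp.coeFn_zero _ _ _
  | insert i s hi ih =>
    simp only [Finset.sum_insert hi]
    filter_upwards [ih, Lp.coeFn_add (c i • F i) (∑ i ∈ s, c i • F i), Lp.coeFn_smul (c i) (F i)]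
      with x h1 h2 h3
    rw [h2, Pi.add_apply, h1, h3, Pi.smul_apply, smul_eq_mul]

/-- Functions in the domain with prescribed zeros and controlled energy. -/
theorem IsResolvent.exists_vanishing (ha : 0 < a) (hσ : conj σ * σ = 1)
    (hV : MemLp V ⊤ (cellMeasure a)) (hT : IsResolvent a V σ M T) {ν : ℕ → ℝ}
    (hν : IsEigenvalueSequence a V σ ν) {n : ℕ} (q : Fin n → ℝ) :
    ∃ u v w : ℝ → ℂ, InDomain a σ u v w ∧ (∀ i, u (q i) = 0) ∧
      0 < ∫ x, ‖u x‖ ^ 2 ∂(cellMeasure a) ∧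
      energy a V 0 u v ≤ ν (n + 1) * ∫ x, ‖u x‖ ^ 2 ∂(cellMeasure a) := by
  obtain ⟨e, he, hmem, -⟩ := hT.exists_eigenvectors hν
  let ι : Fin (n + 1) → {j : ℕ // 1 ≤ j} := fun i => ⟨i + 1, by omega⟩
  have hι : Function.Injective ι := fun i j h => by
    have := congrArg Subtype.val h
    exact Fin.ext (by simpa [ι] using this)
  have heι := he.comp ι hι
  have hrep : ∀ i, ∃ u v w : ℝ → ℂ, InDomain a σ u v w ∧ e (ι i) =ᵐ[cellMeasure a] u ∧
      (((ν (ι i) : ℂ) • e (ι i) : L2 a) : ℝ → ℂ) =ᵐ[cellMeasure a]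
        fun x => -w x + (V x : ℂ) * u x := fun i => mem_opGraph_iff.1 (hmem (ι i))
  choose u v w hd hu hw using hrep
  -- Vanishing at n points imposes n linear conditions on the n + 1 coefficients.
  obtain ⟨c, hc0, hc⟩ := exists_ne_zero_orthogonal (F := Fin (n + 1) → ℂ)
    (fun k : Fin n => Fintype.linearCombination ℂ (fun i => u i (q k))) (by simp)
  have hD := InDomain.sum Finset.univ (u := u) (v := v) (w := w) c fun i _ => hd i
  set U := ∑ i, c i • u i with hU
  set W := ∑ i, c i • w i with hW
  have hF : ((∑ i, c i • e (ι i) : L2 a) : ℝ → ℂ) =ᵐ[cellMeasure a] U := by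
    filter_upwards [coeFn_sum_smul Finset.univ c (fun i => e (ι i)), ae_all_iff.2 hu] with x h1 h2
    rw [h1, hU, Finset.sum_apply]
    exact Finset.sum_congr rfl fun i _ => by rw [h2 i]; rfl
  have hG : ((∑ i, (c i * ν (ι i)) • e (ι i) : L2 a) : ℝ → ℂ) =ᵐ[cellMeasure a]
      fun x => -W x + (V x : ℂ) * U x := by
    filter_upwards [coeFn_sum_smul Finset.univ (fun i => c i * ν (ι i)) (fun i => e (ι i)),
      ae_all_iff.2 hw, ae_all_iff.2 fun i => Lp.coeFn_smul (ν (ι i) : ℂ) (e (ι i))] with x h1 h2 h3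
    rw [h1, hU, hW, Finset.sum_apply, Finset.sum_apply, Finset.mul_sum, ← Finset.sum_neg_distrib,
      ← Finset.sum_add_distrib]
    refine Finset.sum_congr rfl fun i _ => ?_
    have h4 := (h3 i).symm.trans (h2 i)
    simp only [Pi.smul_apply, smul_eq_mul] at h4 ⊢
    linear_combination c i * h4
  have hN : ∫ x, ‖U x‖ ^ 2 ∂(cellMeasure a) = ∑ i, ‖c i‖ ^ 2 := by
    rw [← norm_sq_eq_integral hF]; exact norm_sum_smul_sq heι c
  refine ⟨U, _, W, hD, fun k => ?_, ?_, ?_⟩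
  · have := hc k
    rw [Fintype.linearCombination_apply] at this
    simpa [hU] using this
  · rw [hN]
    obtain ⟨j, hj⟩ := Function.ne_iff.1 hc0
    exact Finset.sum_pos' (fun _ _ => by positivity)
      ⟨j, Finset.mem_univ j, by have := norm_pos_iff.2 hj; positivity⟩
  · rw [← re_inner_eq_energy ha hσ hV hD hF hG 0, hN]
    simp only [Complex.ofReal_zero, zero_smul, add_zero]
    have h1 := heι.inner_sum (fun i => c i * ν (ι i)) c Finset.univ
    simp only [Function.comp_apply] at h1
    rw [h1, Complex.re_sum, Finset.mul_sum]
    refine Finset.sum_le_sum fun i _ => ?_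
    have h2 : conj (c i * (ν (ι i) : ℂ)) * c i = ((ν (ι i) * ‖c i‖ ^ 2 : ℝ) : ℂ) := by
      rw [map_mul, Complex.conj_ofReal, mul_right_comm, Complex.conj_mul']; push_cast; ring
    rw [h2, Complex.ofReal_re]
    gcongr
    exact hν.mono _ _ (ι i).2 (by simp only [ι]; omega)

/-- Existence of the eigenvalue sequence, given trial spaces of every dimension. -/
theorem IsResolvent.exists_isEigenvalueSequence (hT : IsResolvent a V σ M T)
    (htrial : ∀ N : ℕ, ∃ (n : ℕ) (_ : NeZero n) (L : (ZMod n → ℂ) →ₗ[ℂ] L2 a) (l : ℝ),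
      N ≤ n ∧ 0 < l ∧ (∀ s, L s = 0 → s = 0) ∧
      ∀ s, ‖L s‖ ^ 2 ≤ l * (inner ℂ (T (L s)) (L s)).re) :
    ∃ ν : ℕ → ℝ, IsEigenvalueSequence a V σ ν := by
  have hfd := hT.finiteDimensional
  have hne : ∀ z : ℂ, Module.finrank ℂ (eigenspace a V σ z) ≠ 0 →
      ∃ g ∈ eigenspace a V σ z, ‖g‖ = 1 := by
    intro z hz
    have hbot : eigenspace a V σ z ≠ ⊥ := fun h => hz (by rw [h]; exact finrank_bot ℂ _)
    obtain ⟨g, hg, hg0⟩ := Submodule.exists_mem_ne_zero_of_ne_bot hbot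
    exact ⟨((‖g‖⁻¹ : ℝ) : ℂ) • g, Submodule.smul_mem _ _ hg, by
      rw [norm_smul, Complex.norm_real, norm_inv, norm_norm,
        inv_mul_cancel₀ (norm_ne_zero_iff.2 hg0)]⟩
  have hzero : ∀ z : ℂ, ((z.re : ℝ) : ℂ) ≠ z → Module.finrank ℂ (eigenspace a V σ z) = 0 := by
    intro z hz
    by_contra h
    obtain ⟨g, hg, hg1⟩ := hne z h
    exact hz (hT.eigenvalue_real hg (fun h0 => by simp [h0] at hg1)).1
  have hfin : ∀ R : ℝ, {z : ℝ | z ≤ R ∧ Module.finrank ℂ (eigenspace a V σ z) ≠ 0}.Finite := by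
    intro R
    by_contra hinf
    have hinf : {z : ℝ | z ≤ R ∧ Module.finrank ℂ (eigenspace a V σ z) ≠ 0}.Infinite := hinf
    have hpos : ∀ z : ℝ, Module.finrank ℂ (eigenspace a V σ z) ≠ 0 → 1 ≤ z + M := fun z hz => by
      obtain ⟨g, hg, hg1⟩ := hne z hz
      simpa using (hT.eigenvalue_real hg (fun h0 => by simp [h0] at hg1)).2
    obtain ⟨z₀, hz₀⟩ := hinf.nonempty
    have hR : 0 < R + M := by linarith [hpos z₀ hz₀.2, hz₀.1]
    -- Eigenvalues of H up to `R` give eigenvalues of `T` of size at least (R + M)⁻¹, and these are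
    -- bounded in number.
    obtain ⟨N, hN⟩ := hT.small.card_le (inv_pos.2 hR)
    obtain ⟨S, hS, hcard⟩ := hinf.exists_subset_card_eq (N + 1)
    choose g hg hg1 using fun z : S => hne (z : ℝ) (hS z.2).2
    have hon : Orthonormal ℂ g := by
      refine ⟨hg1, fun z z' hzz => ?_⟩
      have hz' : ((z : ℝ) : ℂ) ≠ ((z' : ℝ) : ℂ) := fun h => hzz (Subtype.ext (by exact_mod_cast h))
      exact hT.orthogonalFamily hz' ⟨g z, hg z⟩ ⟨g z', hg z'⟩
    have := hN S g (fun z => ((z : ℝ) + M)⁻¹) hon (fun z => by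
      rw [hT.apply_eq (hg z)]; push_cast; rfl) fun z => by
        have h1 := hpos z (hS z.2).2
        have h2 := (hS z.2).1
        exact inv_anti₀ (by linarith) (by linarith)
    rw [Fintype.card_coe, hcard] at this
    omega
  -- If there were finitely many eigenvalues, a large trial space would contain a nonzero vector
  -- orthogonal to all eigenvectors. There ⟨Tf, f⟩ ≤ 0, against the trial bound.
  have hinf : {z : ℝ | Module.finrank ℂ (eigenspace a V σ z) ≠ 0}.Infinite := by
    intro hf
    let ι := Σ z : hf.toFinset, Fin (Module.finrank ℂ (eigenspace a V σ (z : ℝ)))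
    obtain ⟨n, _, L, l, hn, hl, hL, hLl⟩ := htrial (Fintype.card ι + 1)
    obtain ⟨s, hs0, hs⟩ := exists_ne_zero_orthogonal (F := ZMod n → ℂ)
      (fun i : ι => (innerₛₗ ℂ ((stdOrthonormalBasis ℂ (eigenspace a V σ (i.1 : ℝ)) i.2 :
        eigenspace a V σ (i.1 : ℝ)) : L2 a)) ∘ₗ L) (by rw [Module.finrank_pi, ZMod.card]; omega)
    have h1 := rayleigh_le hT.small.isCompactOperator hT.symm le_rfl (f := L s) fun μ hμ g hg => by
      have hg' := hT.mem_eigenspace_of_apply_eq (by exact_mod_cast hμ.ne') hg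
      have hcast : ((μ : ℂ)⁻¹ - M) = ((μ⁻¹ - M : ℝ) : ℂ) := by push_cast; rfl
      rw [hcast] at hg'
      by_cases hz : μ⁻¹ - M ∈ hf.toFinset
      · have hb := (stdOrthonormalBasis ℂ (eigenspace a V σ ((μ⁻¹ - M : ℝ) : ℂ))).sum_repr
          ⟨g, hg'⟩
        have hb' := congrArg Subtype.val hb
        rw [← show _ = g from hb', Submodule.coe_sum, sum_inner]
        refine Finset.sum_eq_zero fun k _ => ?_
        have hk := hs ⟨⟨μ⁻¹ - M, hz⟩, k⟩
        rw [LinearMap.comp_apply, innerₛₗ_apply_apply] at hk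
        rw [Submodule.coe_smul, inner_smul_left, hk, mul_zero]
      · rw [Finite.mem_toFinset, mem_ofPred_eq, not_not] at hz
        have := hfd ((μ⁻¹ - M : ℝ) : ℂ)
        rw [Submodule.finrank_eq_zero.1 hz, Submodule.mem_bot] at hg'
        rw [hg', inner_zero_left]
    have h2 := hLl s
    have h3 : 0 < ‖L s‖ := norm_pos_iff.2 fun h => hs0 (hL s h)
    rw [zero_mul] at h1
    nlinarith [mul_nonpos_of_nonneg_of_nonpos hl.le h1, mul_pos h3 h3]
  obtain ⟨ν, hmono, hcount⟩ := exists_enumeration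
    (fun z : ℝ => Module.finrank ℂ (eigenspace a V σ z)) hfin hinf
  refine ⟨ν, hmono, hfd, fun z => ?_⟩
  by_cases hz : ((z.re : ℝ) : ℂ) = z
  · rw [← hz, ← hcount z.re]
    congr 1
    ext j
    simp
  · rw [hzero z hz]
    have : {j : ℕ | 1 ≤ j ∧ (ν j : ℂ) = z} = ∅ := by
      ext j
      simp only [mem_ofPred_eq, mem_empty_iff_false, iff_false, not_and]
      rintro - rfl
      exact hz (by simp)
    rw [this]; simp

end

/-! ### Jacobi's comparison method and the lower bound -/

theorem periodic_cos_div_sin : Function.Periodic (fun t => Real.cos t / Real.sin t) Real.pi :=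
  fun t => by simp only [Real.cos_add_pi, Real.sin_add_pi, neg_div_neg_eq]

/-- At a common zero of `u` and of `sin (κ x + t₀)`, the function `κ cot (κ x + t₀) ‖u‖²` is
differentiable. -/
theorem hasDerivAt_cot_mul_norm_sq {κ t₀ q : ℝ} (hκ : κ ≠ 0) {u : ℝ → ℂ} {d : ℂ}
    (hu : HasDerivAt u d q) (h0 : u q = 0) (hq : Real.sin (κ * q + t₀) = 0) :
    HasDerivAt (fun x => κ * (Real.cos (κ * x + t₀) / Real.sin (κ * x + t₀)) * ‖u x‖ ^ 2)
      (‖d‖ ^ 2) q := by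
  have hlin : HasDerivAt (fun x => κ * x + t₀) κ q := by
    simpa using ((hasDerivAt_id q).const_mul κ).add_const t₀
  have hs := hlin.sin
  have hc0 : Real.cos (κ * q + t₀) ≠ 0 := fun h => by
    have := Real.sin_sq_add_cos_sq (κ * q + t₀)
    rw [hq, h] at this
    norm_num at this
  rw [hasDerivAt_iff_tendsto_slope] at hu hs ⊢
  have hcos : Filter.Tendsto (fun x => Real.cos (κ * x + t₀)) (nhdsWithin q {q}ᶜ)
      (nhds (Real.cos (κ * q + t₀))) :=
    (by fun_prop : Continuous fun x => Real.cos (κ * x + t₀)).continuousAt.tendsto.mono_left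
      nhdsWithin_le_nhds
  -- The simple pole of the cotangent meets the double zero of ‖u‖²: the difference quotient is κ
  -- cos times the squared slope of u, divided by the slope of the sine.
  have hlim := ((hcos.const_mul κ).mul (hu.norm.pow 2)).div hs (mul_ne_zero hc0 hκ)
  have hval : κ * Real.cos (κ * q + t₀) * ‖d‖ ^ 2 / (Real.cos (κ * q + t₀) * κ) = ‖d‖ ^ 2 := by
    field_simp
  rw [hval] at hlim
  refine hlim.congr' ?_
  filter_upwards [self_mem_nhdsWithin] with x hx
  have hx' : x - q ≠ 0 := sub_ne_zero.2 hx
  simp only [Pi.div_apply, slope_def_module, h0, hq, sub_zero, norm_smul, smul_eq_mul, norm_zero,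
    div_zero, mul_zero, norm_inv, Real.norm_eq_abs, ne_eq, OfNat.ofNat_ne_zero, not_false_eq_true,
    zero_pow]
  rw [mul_pow, inv_pow, sq_abs]
  rcases eq_or_ne (Real.sin (κ * x + t₀)) 0 with hs0 | hs0
  · simp [hs0]
  · field_simp

/-- Jacobi's lower bound for a quadratic form on functions that vanish at the zeros of
`sin (κ x + t₀)`; the logarithmic derivative of the comparison function is `cot + R`. -/
theorem jacobi_inequality {a κ t₀ : ℝ} (ha : 0 < a) (hκ : κ ≠ 0) {n : ℕ} (hn : κ * a = n * Real.pi)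
    {R R' U : ℝ → ℝ} (hR : ∀ t, HasDerivAt R (R' t) t) (hRp : Function.Periodic R Real.pi)
    (hU : Continuous U)
    (hRU : ∀ t, Real.sin t ≠ 0 →
      R' t + R t ^ 2 + 2 * (Real.cos t / Real.sin t) * R t - 1 ≤ U t)
    {u v : ℝ → ℂ} (hu : ∀ x, HasDerivAt u (v x) x) (hv : Continuous v)
    (h0 : ∀ x ∈ Icc (-a / 2) (a / 2), Real.sin (κ * x + t₀) = 0 → u x = 0)
    (hbc : ‖u (a / 2)‖ = ‖u (-a / 2)‖) :
    0 ≤ ∫ x in (-a / 2)..(a / 2), (‖v x‖ ^ 2 + κ ^ 2 * U (κ * x + t₀) * ‖u x‖ ^ 2) := by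
  have hlr : -a / 2 ≤ a / 2 := by linarith
  set γ : ℝ → ℝ := fun t => Real.cos t / Real.sin t + R t with hγ
  have hγp : Function.Periodic γ Real.pi := periodic_cos_div_sin.add hRp
  set G : ℝ → ℝ := fun x => κ * γ (κ * x + t₀) * ‖u x‖ ^ 2 with hG
  have hlin : ∀ x, HasDerivAt (fun x => κ * x + t₀) κ x := fun x => by
    simpa using ((hasDerivAt_id x).const_mul κ).add_const t₀
  have hN : ∀ x, HasDerivAt (fun x => ‖u x‖ ^ 2) (2 * inner ℝ (u x) (v x)) x := fun x =>
    (hu x).norm_sq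
  have hd : ∀ x ∈ Icc (-a / 2) (a / 2), ∃ d, HasDerivAt G d x ∧
      d ≤ ‖v x‖ ^ 2 + κ ^ 2 * U (κ * x + t₀) * ‖u x‖ ^ 2 := by
    intro x hx
    by_cases hs : Real.sin (κ * x + t₀) = 0
    · have hux := h0 x hx hs
      have d1 := hasDerivAt_cot_mul_norm_sq hκ (hu x) hux hs
      have d2 := (((hR (κ * x + t₀)).comp x (hlin x)).const_mul κ).mul (hN x)
      refine ⟨_, (d1.add d2).congr_of_eventuallyEq (.of_forall fun y => ?_), ?_⟩
      · simp only [hG, hγ, Pi.add_apply, Pi.mul_apply, Function.comp_apply]; ring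
      · simp [hux]
    · have d1 := ((Real.hasDerivAt_cos _).div (Real.hasDerivAt_sin _) hs).add (hR (κ * x + t₀))
      have d2 := ((d1.comp x (hlin x)).const_mul κ).mul (hN x)
      refine ⟨_, d2.congr_of_eventuallyEq (.of_forall fun y => ?_), ?_⟩
      · simp only [hG, hγ, Pi.add_apply, Pi.mul_apply, Pi.div_apply, Function.comp_apply]
      · have hineq := hRU _ hs
        simp only [Pi.add_apply, Pi.div_apply, Function.comp_apply]
        set S := Real.sin (κ * x + t₀)
        set K := Real.cos (κ * x + t₀)
        set ρ := R (κ * x + t₀)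
        set ρ' := R' (κ * x + t₀)
        set I : ℝ := inner ℝ (u x) (v x)
        have e1 : (-S * S - K * K) / S ^ 2 = -1 - (K / S) ^ 2 := by field_simp
        rw [e1]
        -- With g = κγ, 2g Re⟨u, v⟩ ≤ ‖v‖² + g²‖u‖². Since cot' + cot² = -1, the hypothesis on `R`
        -- and `U` is the Riccati inequality γ' + γ² ≤ U, whence G' is at most the integrand.
        have hI : 2 * (κ * (K / S + ρ)) * I ≤ ‖v x‖ ^ 2 + κ ^ 2 * (K / S + ρ) ^ 2 * ‖u x‖ ^ 2 := by
          have hI' : |I| ≤ ‖u x‖ * ‖v x‖ := abs_real_inner_le_norm _ _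
          have h1 : 2 * (κ * (K / S + ρ)) * I ≤ 2 * |κ * (K / S + ρ)| * (‖u x‖ * ‖v x‖) := by
            refine (le_abs_self _).trans ?_
            rw [abs_mul, abs_mul, abs_two]
            gcongr
          have h2 : κ ^ 2 * (K / S + ρ) ^ 2 = |κ * (K / S + ρ)| ^ 2 := by rw [sq_abs]; ring
          rw [h2]
          nlinarith [sq_nonneg (‖v x‖ - |κ * (K / S + ρ)| * ‖u x‖)]
        have hm := mul_le_mul_of_nonneg_left hineq
          (by positivity : 0 ≤ κ ^ 2 * ‖u x‖ ^ 2)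
        nlinarith [hm, hI]
  have hcont : ContinuousOn G (Icc (-a / 2) (a / 2)) := fun x hx => by
    obtain ⟨d, h1, -⟩ := hd x hx
    exact h1.continuousAt.continuousWithinAt
  have hucont : Continuous u := continuous_iff_continuousAt.2 fun x => (hu x).continuousAt
  have hφ : Continuous fun x => ‖v x‖ ^ 2 + κ ^ 2 * U (κ * x + t₀) * ‖u x‖ ^ 2 := by fun_prop
  have key := intervalIntegral.sub_le_integral_of_hasDeriv_right_of_le (g := G) (g' := deriv G)
    hlr hcont (fun x hx => by
      obtain ⟨d, h1, -⟩ := hd x (Ioo_subset_Icc_self hx)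
      exact h1.differentiableAt.hasDerivAt.hasDerivWithinAt)
    (hφ.continuousOn.integrableOn_compact isCompact_Icc) (fun x hx => by
      obtain ⟨d, h1, h2⟩ := hd x (Ioo_subset_Icc_self hx)
      rw [h1.deriv]; exact h2)
  -- No boundary term survives: γ has period π and κa = nπ.
  have hper : G (a / 2) = G (-a / 2) := by
    simp only [hG]
    rw [hbc]
    have : κ * (a / 2) + t₀ = κ * (-a / 2) + t₀ + n * Real.pi := by linear_combination hn
    rw [this, hγp.nat_mul n]
  rwa [hper, sub_self] at key

/-- The first comparison function is the sine. -/
theorem wirtinger {a κ t₀ : ℝ} (ha : 0 < a) (hκ : κ ≠ 0) {n : ℕ} (hn : κ * a = n * Real.pi)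
    {u v : ℝ → ℂ} (hu : ∀ x, HasDerivAt u (v x) x) (hv : Continuous v)
    (h0 : ∀ x ∈ Icc (-a / 2) (a / 2), Real.sin (κ * x + t₀) = 0 → u x = 0)
    (hbc : ‖u (a / 2)‖ = ‖u (-a / 2)‖) :
    0 ≤ ∫ x in (-a / 2)..(a / 2), (‖v x‖ ^ 2 + κ ^ 2 * (-1) * ‖u x‖ ^ 2) :=
  jacobi_inequality ha hκ hn (R := fun _ => 0) (R' := fun _ => 0) (U := fun _ => -1)
    (fun t => hasDerivAt_const t 0) (fun _ => rfl) continuous_const (fun t _ => by simp) hu hv h0 hbc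

theorem cubic_pos {y : ℝ} (hy : -1 ≤ y) : 0 < y ^ 3 + 4 * y ^ 2 + 8 * y + 6 := by
  have h : 0 ≤ y + 1 := by linarith
  have : y ^ 3 + 4 * y ^ 2 + 8 * y + 6 = (y + 1) ^ 3 + (y + 1) ^ 2 + 3 * (y + 1) + 1 := by ring
  rw [this]; positivity

/-- The second comparison function is `sin t * p (cos 2t)` with `p y = y³ + 4y² + 8y + 6`. -/
theorem mathieu_inequality {a κ t₀ : ℝ} (ha : 0 < a) (hκ : κ ≠ 0) {n : ℕ}
    (hn : κ * a = n * Real.pi)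
    {u v : ℝ → ℂ} (hu : ∀ x, HasDerivAt u (v x) x) (hv : Continuous v)
    (h0 : ∀ x ∈ Icc (-a / 2) (a / 2), Real.sin (κ * x + t₀) = 0 → u x = 0)
    (hbc : ‖u (a / 2)‖ = ‖u (-a / 2)‖) :
    0 ≤ ∫ x in (-a / 2)..(a / 2),
      (‖v x‖ ^ 2 + κ ^ 2 * (-12 * Real.cos (2 * (κ * x + t₀)) - 1) * ‖u x‖ ^ 2) := by
  set p : ℝ → ℝ := fun y => y ^ 3 + 4 * y ^ 2 + 8 * y + 6 with hp
  set p' : ℝ → ℝ := fun y => 3 * y ^ 2 + 8 * y + 8 with hp'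
  have hpos : ∀ t, 0 < p (Real.cos (2 * t)) := fun t => cubic_pos (Real.neg_one_le_cos _)
  refine jacobi_inequality ha hκ hn
    (R := fun t => -2 * Real.sin (2 * t) * p' (Real.cos (2 * t)) / p (Real.cos (2 * t)))
    (R' := fun t => (-4 * Real.cos (2 * t) * p' (Real.cos (2 * t))
      + 4 * Real.sin (2 * t) ^ 2 * (6 * Real.cos (2 * t) + 8)) / p (Real.cos (2 * t))
      - (2 * Real.sin (2 * t) * p' (Real.cos (2 * t)) / p (Real.cos (2 * t))) ^ 2)
    (U := fun t => -12 * Real.cos (2 * t) - 1) (fun t => ?_) (fun t => ?_) (by fun_prop)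
    (fun t ht => ?_) hu hv h0 hbc
  · have h2 : HasDerivAt (fun t : ℝ => 2 * t) 2 t := by
      simpa using (hasDerivAt_id t).const_mul (2 : ℝ)
    have hs := h2.sin
    have hc := h2.cos
    have dp : ∀ y, HasDerivAt p (p' y) y := fun y => by
      have := ((((hasDerivAt_id y).pow 3).add (((hasDerivAt_id y).pow 2).const_mul 4)).add
        ((hasDerivAt_id y).const_mul 8)).add_const 6
      refine this.congr_deriv ?_
      simp only [hp', id]; norm_num; ring
    have dp' : ∀ y, HasDerivAt p' (6 * y + 8) y := fun y => by
      have := ((((hasDerivAt_id y).pow 2).const_mul 3).add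
        ((hasDerivAt_id y).const_mul 8)).add_const 8
      refine this.congr_deriv ?_
      simp only [id]; norm_num; ring
    have := ((hs.const_mul (-2)).mul ((dp' _).comp t hc)).div ((dp _).comp t hc) (hpos t).ne'
    refine this.congr_deriv ?_
    simp only [Pi.mul_apply, Function.comp_apply]
    have := (hpos t).ne'
    field_simp
    ring
  · have : 2 * (t + Real.pi) = 2 * t + 2 * Real.pi := by ring
    simp only [this, Real.sin_add_two_pi, Real.cos_add_two_pi]
  · have e1 : 2 * (Real.cos t / Real.sin t) * (-2 * Real.sin (2 * t) * p' (Real.cos (2 * t))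
        / p (Real.cos (2 * t)))
        = -4 * (1 + Real.cos (2 * t)) * p' (Real.cos (2 * t)) / p (Real.cos (2 * t)) := by
      rw [Real.sin_two_mul, Real.cos_two_mul]
      field_simp
      ring
    have e2 : Real.sin (2 * t) ^ 2 = 1 - Real.cos (2 * t) ^ 2 := by
      rw [← Real.sin_sq_add_cos_sq (2 * t)]; ring
    rw [e1, e2]
    have hy := hpos t
    have hy2 := Real.cos_sq_le_one (2 * t)
    set y := Real.cos (2 * t)
    have e3 : (-4 * y * p' y + 4 * (1 - y ^ 2) * (6 * y + 8)) / p y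
        - (2 * Real.sin (2 * t) * p' y / p y) ^ 2
        + (-2 * Real.sin (2 * t) * p' y / p y) ^ 2 + -4 * (1 + y) * p' y / p y - 1
        -- This is f″/f for the comparison function f; the cubic leaves a remainder of one sign, as
        -- |y| ≤ 1.
        = -12 * y - 1 - 12 * (y ^ 2 * (1 - y ^ 2)) / p y := by
      have num : -4 * y * p' y + 4 * (1 - y ^ 2) * (6 * y + 8) + -4 * (1 + y) * p' y
          = -12 * y * p y - 12 * (y ^ 2 * (1 - y ^ 2)) := by simp only [hp, hp']; ring
      trans (-4 * y * p' y + 4 * (1 - y ^ 2) * (6 * y + 8) + -4 * (1 + y) * p' y) / p y - 1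
      · ring
      · rw [num, sub_div, mul_div_cancel_right₀ _ hy.ne']; ring
    rw [e3]
    have : 0 ≤ 12 * (y ^ 2 * (1 - y ^ 2)) / p y := by
      have : 0 ≤ 1 - y ^ 2 := by linarith
      positivity
    linarith

/-- The zeros of `sin (κ x + t₀)` in a half-open interval of length `nπ/κ`. -/
theorem exists_zeros {a κ t₀ : ℝ} (hκ : 0 < κ) {n : ℕ} (hn : κ * a = n * Real.pi) :
    ∃ q : Fin n → ℝ, ∀ x ∈ Ico (-a / 2) (a / 2), Real.sin (κ * x + t₀) = 0 → ∃ i, x = q i := by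
  -- The phase grows by exactly nπ over the half-open interval, so the zeros there are those with
  -- multiples k₀π, …, (k₀ + n - 1)π.
  set k₀ : ℤ := ⌈(κ * (-a / 2) + t₀) / Real.pi⌉ with hk₀
  refine ⟨fun i => (((k₀ + i : ℤ) : ℝ) * Real.pi - t₀) / κ, fun x hx hs => ?_⟩
  obtain ⟨k, hk⟩ := Real.sin_eq_zero_iff.1 hs
  have hπ := Real.pi_pos
  have h1 : k₀ ≤ k := by
    rw [hk₀, Int.ceil_le, div_le_iff₀ hπ, hk]
    nlinarith [hx.1]
  have h2 : k < k₀ + n := by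
    have h3 : (κ * (-a / 2) + t₀) / Real.pi ≤ k₀ := Int.le_ceil _
    rw [div_le_iff₀ hπ] at h3
    have h4 : (k : ℝ) * Real.pi < (k₀ + n : ℝ) * Real.pi := by
      rw [hk]
      nlinarith [mul_lt_mul_of_pos_left hx.2 hκ]
    have := lt_of_mul_lt_mul_right h4 hπ.le
    exact_mod_cast this
  refine ⟨⟨(k - k₀).toNat, by omega⟩, ?_⟩
  have h5 : k₀ + ((k - k₀).toNat : ℤ) = k := by omega
  simp only [h5, hk]
  field_simp
  ring

/-- A function in the domain is the restriction of a continuously differentiable function. -/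
theorem IsH2.exists_extension {a : ℝ} (ha : 0 < a) {u v w : ℝ → ℂ} (h : IsH2 a u v w) :
    ∃ u₁ v₁ : ℝ → ℂ, (∀ x, HasDerivAt u₁ (v₁ x) x) ∧ Continuous v₁ ∧
      ∀ x ∈ Icc (-a / 2) (a / 2), u₁ x = u x ∧ v₁ x = v x := by
  have hlr : -a / 2 ≤ a / 2 := by linarith
  set v₁ : ℝ → ℂ := IccExtend hlr ((Icc (-a / 2) (a / 2)).domRestrict v) with hv₁
  have hc : Continuous v₁ := (continuousOn_iff_continuous_domRestrict.1 h.continuousOn_v).Icc_extend'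
  have hev : ∀ x ∈ Icc (-a / 2) (a / 2), v₁ x = v x := fun x hx => by
    rw [hv₁, IccExtend_of_mem hlr _ hx]; rfl
  refine ⟨fun x => u (-a / 2) + ∫ t in (-a / 2)..x, v₁ t, v₁, fun x => ?_, hc, fun x hx =>
    ⟨?_, hev x hx⟩⟩
  · exact (hc.integral_hasStrictDerivAt _ x).hasDerivAt.const_add _
  · rw [h.eq_u x hx]
    refine congrArg (u (-a / 2) + ·) (intervalIntegral.integral_congr fun t ht => ?_)
    rw [uIcc_of_le hx.1] at ht
    exact hev t ⟨ht.1, ht.2.trans hx.2⟩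

/-- Lower bound for the energy of functions vanishing at the maxima of the leading harmonic. -/
theorem InDomain.energy_ge {a : ℝ} (ha : 0 < a) {V : ℝ → ℝ} (hV : MemLp V ⊤ (cellMeasure a)) {σ : ℂ}
    (hσ : conj σ * σ = 1) {u v w : ℝ → ℂ} (h : InDomain a σ u v w) {κ t₀ : ℝ} (hκ : 0 < κ) {n : ℕ}
    (hn : κ * a = n * Real.pi) {b c ε : ℝ} (hc0 : 0 ≤ c) (hc : c ≤ 12 * κ ^ 2)
    (hVb : ∀ᵐ x ∂(cellMeasure a), b - c * Real.cos (2 * (κ * x + t₀)) - ε ≤ V x)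
    (h0 : ∀ x ∈ Ico (-a / 2) (a / 2), Real.sin (κ * x + t₀) = 0 → u x = 0) :
    (b + κ ^ 2 - ε) * ∫ x, ‖u x‖ ^ 2 ∂(cellMeasure a) ≤ energy a V 0 u v := by
  obtain ⟨u₁, v₁, hu₁, hv₁, heq⟩ := h.isH2.exists_extension ha
  have hlr : -a / 2 ≤ a / 2 := by linarith
  have hσ1 : ‖σ‖ = 1 := by
    have : ‖conj σ * σ‖ = 1 := by rw [hσ]; simp
    rw [norm_mul, RCLike.norm_conj] at this
    nlinarith [norm_nonneg σ]
  have hl := left_mem_Icc.2 hlr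
  have hr := right_mem_Icc.2 hlr
  have hbc : ‖u₁ (a / 2)‖ = ‖u₁ (-a / 2)‖ := by
    rw [(heq _ hl).1, (heq _ hr).1, h.bc_u, norm_mul, hσ1, one_mul]
  have h0' : ∀ x ∈ Icc (-a / 2) (a / 2), Real.sin (κ * x + t₀) = 0 → u₁ x = 0 := by
    intro x hx hs
    rcases hx.2.lt_or_eq with hlt | rfl
    · rw [(heq x hx).1]; exact h0 x ⟨hx.1, hlt⟩ hs
    · rw [← norm_eq_zero, hbc, norm_eq_zero, (heq _ hl).1]
      refine h0 _ ⟨le_rfl, by linarith⟩ ?_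
      have : κ * (-a / 2) + t₀ = κ * (a / 2) + t₀ - n * Real.pi := by linear_combination -hn
      rw [this, Real.sin_sub_nat_mul_pi, hs, mul_zero]
  have j1 := wirtinger ha hκ.ne' hn hu₁ hv₁ h0' hbc
  have j2 := mathieu_inequality ha hκ.ne' hn hu₁ hv₁ h0' hbc
  have hu₁c : Continuous u₁ := continuous_iff_continuousAt.2 fun x => (hu₁ x).continuousAt
  -- The form is affine in c; the convex combination with weight θ of the cases c = 0 and c = 12κ²
  -- is the case wanted.
  set θ := c / (12 * κ ^ 2) with hθ
  have hκ2 : 0 < 12 * κ ^ 2 := by positivity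
  have hθ0 : 0 ≤ θ := by positivity
  have hθ1 : θ ≤ 1 := (div_le_one hκ2).2 hc
  have hθc : θ * (12 * κ ^ 2) = c := div_mul_cancel₀ _ hκ2.ne'
  have j3 := add_nonneg (mul_nonneg (sub_nonneg.2 hθ1) j1) (mul_nonneg hθ0 j2)
  rw [← intervalIntegral.integral_const_mul, ← intervalIntegral.integral_const_mul,
    ← intervalIntegral.integral_add] at j3
  · have e : ∫ x in (-a / 2)..(a / 2), ((1 - θ) * (‖v₁ x‖ ^ 2 + κ ^ 2 * (-1) * ‖u₁ x‖ ^ 2)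
        + θ * (‖v₁ x‖ ^ 2 + κ ^ 2 * (-12 * Real.cos (2 * (κ * x + t₀)) - 1) * ‖u₁ x‖ ^ 2))
        = ∫ x in (-a / 2)..(a / 2),
          (‖v x‖ ^ 2 - (c * Real.cos (2 * (κ * x + t₀)) + κ ^ 2) * ‖u x‖ ^ 2) := by
      refine intervalIntegral.integral_congr fun x hx => ?_
      rw [uIcc_of_le hlr] at hx
      simp only [(heq x hx).1, (heq x hx).2, ← hθc]
      ring
    rw [e, ← integral_cellMeasure ha] at j3
    have mu := memLp_of_continuousOn h.isH2.continuousOn_u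
    have mv := memLp_of_continuousOn h.isH2.continuousOn_v
    have iN := integrable_norm_sq mu
    have iE : Integrable (fun x => ‖v x‖ ^ 2 + (V x + 0) * ‖u x‖ ^ 2) (cellMeasure a) :=
      (integrable_norm_sq mv).add (integrable_potential_mul_norm_sq hV mu 0)
    have iC : Integrable (fun x => ‖v x‖ ^ 2
        - (c * Real.cos (2 * (κ * x + t₀)) + κ ^ 2) * ‖u x‖ ^ 2) (cellMeasure a) := by
      rw [integrable_cellMeasure_iff ha]
      have cu : ContinuousOn u (uIcc (-a / 2) (a / 2)) := by
        rw [uIcc_of_le hlr]; exact h.isH2.continuousOn_u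
      have cv : ContinuousOn v (uIcc (-a / 2) (a / 2)) := by
        rw [uIcc_of_le hlr]; exact h.isH2.continuousOn_v
      exact ((cv.norm.pow 2).sub (((by fun_prop : Continuous fun x =>
        c * Real.cos (2 * (κ * x + t₀)) + κ ^ 2).continuousOn).mul (cu.norm.pow 2))).intervalIntegrable
    have hmono : ∫ x, ((‖v x‖ ^ 2 - (c * Real.cos (2 * (κ * x + t₀)) + κ ^ 2) * ‖u x‖ ^ 2)
        + (b + κ ^ 2 - ε) * ‖u x‖ ^ 2) ∂(cellMeasure a) ≤ energy a V 0 u v := by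
      refine integral_mono_ae (iC.add (iN.const_mul _)) iE ?_
      filter_upwards [hVb] with x hx
      simp only [add_zero]
      nlinarith [mul_le_mul_of_nonneg_right hx (sq_nonneg ‖u x‖)]
    rw [integral_add iC (iN.const_mul _), integral_const_mul] at hmono
    linarith
  · exact (by fun_prop : Continuous _).intervalIntegrable _ _
  · exact (by fun_prop : Continuous _).intervalIntegrable _ _

/-! ### Trial functions built from sine arcs -/

section

section Cells

variable {E : Type*} {n : ℕ} {a κ t₀ : ℝ}

/-- The function that is constant equal to `s k` where `kπ ≤ κ x + t₀ < (k + 1)π`, with the cells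
numbered modulo `n`. -/
def cellValue (κ t₀ : ℝ) (s : ZMod n → E) (x : ℝ) : E :=
  s ((⌊(κ * x + t₀) / Real.pi⌋ : ℤ) : ZMod n)

theorem exists_norm_cellValue_le [NormedAddCommGroup E] [NeZero n] (s : ZMod n → E) :
    ∃ C : ℝ, ∀ x, ‖cellValue κ t₀ s x‖ ≤ C :=
  ⟨∑ i, ‖s i‖, fun _ => Finset.single_le_sum (f := fun i => ‖s i‖) (fun _ _ => norm_nonneg _)
    (Finset.mem_univ _)⟩

theorem stronglyMeasurable_cellValue [TopologicalSpace E] [NeZero n] (s : ZMod n → E) :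
    StronglyMeasurable (cellValue κ t₀ s) := by
  have h1 : Measurable fun x : ℝ => ⌊(κ * x + t₀) / Real.pi⌋ :=
    Int.measurable_floor.comp (by fun_prop)
  have h2 : StronglyMeasurable fun k : ℤ => s ((k : ℤ) : ZMod n) :=
    StronglyMeasurable.of_discrete
  exact h2.comp_measurable h1

theorem eventually_cellValue_eq (s : ZMod n → E) {x : ℝ} (hx : Real.sin (κ * x + t₀) ≠ 0) :
    ∀ᶠ y in nhds x, cellValue κ t₀ s y = cellValue κ t₀ s x := by
  have hπ := Real.pi_pos
  set k := ⌊(κ * x + t₀) / Real.pi⌋ with hk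
  have hlt : (k : ℝ) < (κ * x + t₀) / Real.pi := by
    refine lt_of_le_of_ne (Int.floor_le _) fun h => hx ?_
    have : κ * x + t₀ = k * Real.pi := by
      rw [h]; exact (div_mul_cancel₀ _ hπ.ne').symm
    rw [this, Real.sin_int_mul_pi]
  have hlt2 : (κ * x + t₀) / Real.pi < k + 1 := Int.lt_floor_add_one _
  have hc : Continuous fun y : ℝ => (κ * y + t₀) / Real.pi := by fun_prop
  filter_upwards [hc.continuousAt.eventually (lt_mem_nhds hlt),
    hc.continuousAt.eventually (gt_mem_nhds hlt2)] with y h1 h2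
  have : ⌊(κ * y + t₀) / Real.pi⌋ = k := Int.floor_eq_iff.2 ⟨h1.le, h2⟩
  rw [cellValue, cellValue, this, ← hk]

theorem cellValue_right [NeZero n] (hn : κ * a = n * Real.pi) (s : ZMod n → E) :
    cellValue κ t₀ s (a / 2) = cellValue κ t₀ s (-a / 2) := by
  have hπ := Real.pi_pos
  have : (κ * (a / 2) + t₀) / Real.pi = (κ * (-a / 2) + t₀) / Real.pi + (n : ℤ) := by
    field_simp
    push_cast
    linear_combination 2 * hn
  rw [cellValue, cellValue, this, Int.floor_add_intCast]
  simp

variable [NormedAddCommGroup E] [NormedSpace ℝ E] {K K' : ℝ → ℝ}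

/-- The jumps of `cellValue` occur only at zeros of the sine, where the profile `K` vanishes and the
cell values are bounded. -/
theorem continuous_smul_cellValue [NeZero n] (hK : Continuous K)
    (hK0 : ∀ t, Real.sin t = 0 → K t = 0) (s : ZMod n → E) :
    Continuous fun x => K (κ * x + t₀) • cellValue κ t₀ s x := by
  have hKc : Continuous fun x => K (κ * x + t₀) := by fun_prop
  refine continuous_iff_continuousAt.2 fun x => ?_
  by_cases hx : Real.sin (κ * x + t₀) = 0
  · obtain ⟨C, hC⟩ := exists_norm_cellValue_le (κ := κ) (t₀ := t₀) s
    have h0 : K (κ * x + t₀) = 0 := hK0 _ hx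
    rw [ContinuousAt, h0, zero_smul]
    have h1 : Filter.Tendsto (fun y => |K (κ * y + t₀)| * C) (nhds x) (nhds 0) := by
      have := (hKc.abs.mul_const C).tendsto x
      simpa [h0] using this
    refine squeeze_zero_norm (fun y => ?_) h1
    rw [norm_smul, Real.norm_eq_abs]
    exact mul_le_mul_of_nonneg_left (hC y) (abs_nonneg _)
  · refine (hKc.continuousAt.smul (continuousAt_const (y := cellValue κ t₀ s x))).congr ?_
    filter_upwards [eventually_cellValue_eq s hx] with y hy
    rw [hy]; rfl

theorem intervalIntegrable_smul_cellValue [NeZero n] (hK : Continuous K) (s : ZMod n → E)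
    (l r : ℝ) : IntervalIntegrable (fun x => K (κ * x + t₀) • cellValue κ t₀ s x) volume l r := by
  obtain ⟨C, hC⟩ := exists_norm_cellValue_le (κ := κ) (t₀ := t₀) s
  have hKc : Continuous fun x => K (κ * x + t₀) := by fun_prop
  have h1 : IntervalIntegrable (fun x => C * |K (κ * x + t₀)|) volume l r :=
    (continuous_const.mul hKc.abs).intervalIntegrable l r
  refine h1.mono_fun ((hKc.stronglyMeasurable.smul
    (stronglyMeasurable_cellValue s)).aestronglyMeasurable) (.of_forall fun x => ?_)
  simp only [norm_smul, norm_mul, Real.norm_eq_abs, abs_abs]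
  rw [mul_comm]
  gcongr
  exact (hC x).trans (le_abs_self C)

/-- Fundamental theorem of calculus for a smooth profile vanishing at the ends of the cells. -/
theorem integral_smul_cellValue [CompleteSpace E] [NeZero n] (hκ : κ ≠ 0)
    (hK : ∀ t, HasDerivAt K (K' t) t)
    (hK' : Continuous K') (hK0 : ∀ t, Real.sin t = 0 → K t = 0) (s : ZMod n → E) (l r : ℝ) :
    ∫ x in l..r, (κ * K' (κ * x + t₀)) • cellValue κ t₀ s x
      = K (κ * r + t₀) • cellValue κ t₀ s r - K (κ * l + t₀) • cellValue κ t₀ s l := by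
  have hKc : Continuous K := continuous_iff_continuousAt.2 fun t => (hK t).continuousAt
  refine integral_eq_of_hasDerivAt_off_countable
    (fun x => K (κ * x + t₀) • cellValue κ t₀ s x) _ (s := {x | Real.sin (κ * x + t₀) = 0})
    ?_ (continuous_smul_cellValue hKc hK0 s).continuousOn (fun x hx => ?_)
    (intervalIntegrable_smul_cellValue (K := fun t => κ * K' t) (by fun_prop) s l r)
  · refine (countable_range fun k : ℤ => (k * Real.pi - t₀) / κ).mono fun x hx => ?_
    obtain ⟨k, hk⟩ := Real.sin_eq_zero_iff.1 hx
    refine ⟨k, ?_⟩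
    simp only [hk]
    field_simp
    ring
  · have hlin : HasDerivAt (fun x => κ * x + t₀) κ x := by
      simpa using ((hasDerivAt_id x).const_mul κ).add_const t₀
    have h1 := ((hK (κ * x + t₀)).comp x hlin).smul_const (cellValue κ t₀ s x)
    rw [mul_comm κ]
    refine h1.congr_of_eventuallyEq ?_
    filter_upwards [eventually_cellValue_eq s hx.2] with y hy
    rw [hy]; rfl

end Cells

variable {a : ℝ} {V : ℝ → ℝ} {σ : ℂ} {κ t₀ : ℝ} {n : ℕ}

/-- Trial function: a multiple of `sin (κ x + t₀)` on every cell. -/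
def trial (κ t₀ : ℝ) (s : ZMod n → ℂ) (x : ℝ) : ℂ :=
  Real.sin (κ * x + t₀) • cellValue κ t₀ s x

/-- Derivative of the trial function. -/
def trialDeriv (κ t₀ : ℝ) (s : ZMod n → ℂ) (x : ℝ) : ℂ :=
  (κ * Real.cos (κ * x + t₀)) • cellValue κ t₀ s x

theorem continuous_trial [NeZero n] (s : ZMod n → ℂ) : Continuous (trial κ t₀ s) :=
  continuous_smul_cellValue Real.continuous_sin (fun _ h => h) s

/-- Across the interval the sine gains the factor (-1)^n while the cell values, numbered modulo n,
return to themselves. This ties the sign σ to the parity of n. -/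
theorem isFormFunction_trial [NeZero n] (hκ : κ ≠ 0) (hn : κ * a = n * Real.pi)
    (hσ : σ = (-1) ^ n) (s : ZMod n → ℂ) :
    IsFormFunction a σ (trial κ t₀ s) (trialDeriv κ t₀ s) where
  memLp := by
    obtain ⟨C, hC⟩ := exists_norm_cellValue_le (κ := κ) (t₀ := t₀) s
    refine MemLp.of_bound (((by fun_prop : Continuous fun x : ℝ =>
      κ * Real.cos (κ * x + t₀)).stronglyMeasurable.smul
      (stronglyMeasurable_cellValue s)).aestronglyMeasurable) (|κ| * C) (.of_forall fun x => ?_)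
    rw [trialDeriv, norm_smul, norm_mul, Real.norm_eq_abs, Real.norm_eq_abs]
    have h1 := Real.abs_cos_le_one (κ * x + t₀)
    have h2 : |κ| * |Real.cos (κ * x + t₀)| ≤ |κ| := by nlinarith [abs_nonneg κ]
    exact mul_le_mul h2 (hC x) (norm_nonneg _) (abs_nonneg _)
  eq_f x _ := by
    have := integral_smul_cellValue (t₀ := t₀) hκ Real.hasDerivAt_sin Real.continuous_cos
      (fun _ h => h) s (-a / 2) x
    simp only [trial, trialDeriv]
    rw [this]; ring
  bc := by
    have : κ * (a / 2) + t₀ = κ * (-a / 2) + t₀ + n * Real.pi := by linear_combination hn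
    rw [trial, trial, cellValue_right hn, this, Real.sin_add_nat_mul_pi, hσ]
    simp only [Complex.real_smul]
    push_cast; ring
  continuousOn := (continuous_trial s).continuousOn

theorem trial_energy_le [NeZero n] (ha : 0 < a) (hV : MemLp V ⊤ (cellMeasure a)) (hκ : κ ≠ 0)
    (hn : κ * a = n * Real.pi) (hσ : σ = (-1) ^ n) {b c ε : ℝ}
    (hVb : ∀ᵐ x ∂(cellMeasure a), V x ≤ b + c * Real.cos (2 * (κ * x + t₀)) + ε) (M : ℝ)
    (s : ZMod n → ℂ) :
    energy a V M (trial κ t₀ s) (trialDeriv κ t₀ s)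
      ≤ (b + κ ^ 2 - c / 2 + ε + M) * ∫ x, ‖trial κ t₀ s x‖ ^ 2 ∂(cellMeasure a) := by
  have hff := isFormFunction_trial (t₀ := t₀) hκ hn hσ s
  have mf := memLp_of_continuousOn hff.continuousOn
  -- `k` is κ² cos²t + c cos 2t sin²t - (κ² - c/2) sin²t. Its primitive `K` vanishes at the zeros of
  -- the sine, so the weighted integral of `k` is zero whatever the cell values.
  set k : ℝ → ℝ := fun t => κ ^ 2 * Real.cos (2 * t)
    + c / 4 * (Real.cos (2 * t) - Real.cos (4 * t)) with hk
  set K : ℝ → ℝ := fun t => (κ ^ 2 / 2 + c / 8) * Real.sin (2 * t) - c / 16 * Real.sin (4 * t)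
  have hK : ∀ t, HasDerivAt K (k t) t := fun t => by
    have h2 : HasDerivAt (fun t : ℝ => 2 * t) 2 t := by
      simpa using (hasDerivAt_id t).const_mul (2 : ℝ)
    have h4 : HasDerivAt (fun t : ℝ => 4 * t) 4 t := by
      simpa using (hasDerivAt_id t).const_mul (4 : ℝ)
    refine ((h2.sin.const_mul (κ ^ 2 / 2 + c / 8)).sub (h4.sin.const_mul (c / 16))).congr_deriv ?_
    simp only [hk]; ring
  have hK0 : ∀ t, Real.sin t = 0 → K t = 0 := fun t ht => by
    have h4 : Real.sin (4 * t) = 2 * Real.sin (2 * t) * Real.cos (2 * t) := by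
      rw [← Real.sin_two_mul]; congr 1; ring
    simp only [K]
    rw [h4, Real.sin_two_mul, ht]; ring
  have hKp : K (κ * (a / 2) + t₀) = K (κ * (-a / 2) + t₀) := by
    have e2 : 2 * (κ * (a / 2) + t₀) = 2 * (κ * (-a / 2) + t₀) + n * (2 * Real.pi) := by
      linear_combination 2 * hn
    have e4 : 4 * (κ * (a / 2) + t₀) = 4 * (κ * (-a / 2) + t₀) + (2 * n : ℕ) * (2 * Real.pi) := by
      push_cast; linear_combination 4 * hn
    simp only [K]
    rw [e2, e4, Real.sin_add_nat_mul_two_pi, Real.sin_add_nat_mul_two_pi]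
  have hkc : Continuous k := by fun_prop
  have hzero : ∫ x in (-a / 2)..(a / 2),
      k (κ * x + t₀) • cellValue κ t₀ (fun i => ‖s i‖ ^ 2) x = 0 := by
    have h1 := integral_smul_cellValue (t₀ := t₀) hκ hK hkc hK0 (fun i => ‖s i‖ ^ 2)
      (-a / 2) (a / 2)
    rw [hKp, cellValue_right hn, sub_self] at h1
    simp only [mul_smul] at h1
    rw [intervalIntegral.integral_smul, smul_eq_zero] at h1
    exact h1.resolve_left hκ
  have hik : Integrable (fun x => k (κ * x + t₀) • cellValue κ t₀ (fun i => ‖s i‖ ^ 2) x)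
      (cellMeasure a) :=
    (integrable_cellMeasure_iff ha).2 (intervalIntegrable_smul_cellValue hkc _ _ _)
  have iN := integrable_norm_sq mf
  rw [← integral_cellMeasure ha] at hzero
  have hmono : energy a V M (trial κ t₀ s) (trialDeriv κ t₀ s)
      ≤ ∫ x, (k (κ * x + t₀) • cellValue κ t₀ (fun i => ‖s i‖ ^ 2) x
        + (b + κ ^ 2 - c / 2 + ε + M) * ‖trial κ t₀ s x‖ ^ 2) ∂(cellMeasure a) := by
    refine integral_mono_ae
      ((integrable_norm_sq hff.memLp).add (integrable_potential_mul_norm_sq hV mf M))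
      (hik.add (iN.const_mul _)) ?_
    filter_upwards [hVb] with x hx
    have e1 : ‖trialDeriv κ t₀ s x‖ ^ 2
        = κ ^ 2 * Real.cos (κ * x + t₀) ^ 2 * ‖cellValue κ t₀ s x‖ ^ 2 := by
      rw [trialDeriv, norm_smul, mul_pow, Real.norm_eq_abs, sq_abs, mul_pow]
    have e2 : ‖trial κ t₀ s x‖ ^ 2
        = Real.sin (κ * x + t₀) ^ 2 * ‖cellValue κ t₀ s x‖ ^ 2 := by
      rw [trial, norm_smul, mul_pow, Real.norm_eq_abs, sq_abs]
    have e3 : cellValue κ t₀ (fun i => ‖s i‖ ^ 2) x = ‖cellValue κ t₀ s x‖ ^ 2 := rfl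
    simp only [e1, e2, e3, smul_eq_mul, hk]
    have e4 : Real.cos (4 * (κ * x + t₀)) = 2 * Real.cos (2 * (κ * x + t₀)) ^ 2 - 1 := by
      rw [← Real.cos_two_mul]; congr 1; ring
    have e5 : Real.cos (κ * x + t₀) ^ 2 = (1 + Real.cos (2 * (κ * x + t₀))) / 2 := by
      rw [Real.cos_sq]; ring
    have e6 : Real.sin (κ * x + t₀) ^ 2 = (1 - Real.cos (2 * (κ * x + t₀))) / 2 := by
      rw [Real.sin_sq, e5]; ring
    have hs := mul_le_mul_of_nonneg_right hx
      (by positivity : 0 ≤ Real.sin (κ * x + t₀) ^ 2 * ‖cellValue κ t₀ s x‖ ^ 2)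
    rw [e6] at hs
    rw [e4, e5, e6]
    nlinarith [hs]
  rwa [integral_add hik (iN.const_mul _), hzero, zero_add, integral_const_mul] at hmono

theorem eq_zero_of_trial_ae_eq_zero [NeZero n] (hκ : 0 < κ)
    (hn : κ * a = n * Real.pi) {s : ZMod n → ℂ} (h : trial κ t₀ s =ᵐ[cellMeasure a] 0) :
    s = 0 := by
  have hπ := Real.pi_pos
  have hEq : EqOn (trial κ t₀ s) 0 (Ioo (-a / 2) (a / 2)) :=
    Measure.eqOn_open_of_ae_eq h isOpen_Ioo (continuous_trial s).continuousOn
      continuousOn_const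
  funext i
  set tl := κ * (-a / 2) + t₀ with htl
  set k₀ : ℤ := ⌈tl / Real.pi⌉ with hk₀
  -- The representative of the class `i` whose cell starts inside the interval. That cell may be cut
  -- by the right endpoint, hence the minimum in the choice of `t` below.
  set k : ℤ := k₀ + ((i - (k₀ : ZMod n)).val : ℤ) with hk
  have hki : ((k : ℤ) : ZMod n) = i := by
    rw [hk]; push_cast; rw [ZMod.natCast_zmod_val]; ring
  have hval : (i - (k₀ : ZMod n)).val < n := ZMod.val_lt _
  have h1 : tl ≤ k * Real.pi := by
    have h2 : tl / Real.pi ≤ k₀ := Int.le_ceil _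
    have h3 : (k₀ : ℝ) ≤ k := by exact_mod_cast (by omega : k₀ ≤ k)
    rw [← div_le_iff₀ hπ]; linarith
  have h4 : (k : ℝ) * Real.pi < tl + n * Real.pi := by
    have h2 : (k₀ : ℝ) < tl / Real.pi + 1 := Int.ceil_lt_add_one _
    have h3 : (k : ℝ) ≤ k₀ + (n - 1) := by
      have : k ≤ k₀ + (n - 1) := by omega
      exact_mod_cast this
    have h5 : (k : ℝ) < tl / Real.pi + n := by linarith
    have := mul_lt_mul_of_pos_right h5 hπ
    rwa [add_mul, div_mul_cancel₀ _ hπ.ne'] at this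
  obtain ⟨t, ht1, ht2⟩ := exists_between
    (lt_min h4 (by linarith : (k : ℝ) * Real.pi < k * Real.pi + Real.pi))
  have ht3 := ht2.trans_le (min_le_left _ _)
  have ht4 := ht2.trans_le (min_le_right _ _)
  have hx : κ * ((t - t₀) / κ) + t₀ = t := by field_simp; ring
  have hmem : (t - t₀) / κ ∈ Ioo (-a / 2) (a / 2) := by
    constructor
    · rw [lt_div_iff₀ hκ]; linarith
    · rw [div_lt_iff₀ hκ]; linarith
  have hz := hEq hmem
  have hfl : ⌊t / Real.pi⌋ = k := by
    rw [Int.floor_eq_iff]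
    constructor
    · rw [le_div_iff₀ hπ]; exact ht1.le
    · rw [div_lt_iff₀ hπ]; linarith
  have hsin : Real.sin t ≠ 0 := fun h0 => by
    obtain ⟨m, hm⟩ := Real.sin_eq_zero_iff.1 h0
    rw [← hm] at ht1 ht4
    have h5 : (k : ℝ) < m := lt_of_mul_lt_mul_right ht1 hπ.le
    have h6 : (m : ℝ) < k + 1 := lt_of_mul_lt_mul_right (by linarith) hπ.le
    have h5' : k < m := by exact_mod_cast h5
    have h6' : m < k + 1 := by exact_mod_cast h6
    omega
  rw [trial, cellValue, hx, hfl, hki, Pi.zero_apply, smul_eq_zero] at hz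
  exact hz.resolve_left hsin

/-- The trial space of dimension `n`. -/
theorem IsResolvent.exists_trial_space [NeZero n] (ha : 0 < a) (hσ1 : conj σ * σ = 1)
    (hV : MemLp V ⊤ (cellMeasure a)) {C M : ℝ} (hC : ∀ᵐ x ∂(cellMeasure a), |V x| ≤ C)
    (hM : C + 1 ≤ M) {T : L2 a →L[ℂ] L2 a} (hT : IsResolvent a V σ M T) (hκ : 0 < κ)
    (hn : κ * a = n * Real.pi) (hσ : σ = (-1) ^ n) {b c ε : ℝ}
    (hVb : ∀ᵐ x ∂(cellMeasure a), V x ≤ b + c * Real.cos (2 * (κ * x + t₀)) + ε)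
    (hl : 0 < b + κ ^ 2 - c / 2 + ε + M) :
    ∃ L : (ZMod n → ℂ) →ₗ[ℂ] L2 a, (∀ s, L s = 0 → s = 0) ∧
      ∀ s, ‖L s‖ ^ 2 ≤ (b + κ ^ 2 - c / 2 + ε + M) * (inner ℂ (T (L s)) (L s)).re := by
  have hm (s : ZMod n → ℂ) : MemLp (trial κ t₀ s) 2 (cellMeasure a) :=
    memLp_of_continuousOn (continuous_trial s).continuousOn
  let L : (ZMod n → ℂ) →ₗ[ℂ] L2 a :=
    { toFun := fun s => (hm s).toLp
      map_add' := fun s s' => by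
        rw [← MemLp.toLp_add]
        refine MemLp.toLp_congr _ _ (.of_forall fun x => ?_)
        simp only [trial, cellValue, Pi.add_apply, smul_add]
      map_smul' := fun r s => by
        rw [RingHom.id_apply, ← MemLp.toLp_const_smul]
        refine MemLp.toLp_congr _ _ (.of_forall fun x => ?_)
        simp only [trial, cellValue, Pi.smul_apply, smul_comm r] }
  have hL : ∀ s, L s =ᵐ[cellMeasure a] trial κ t₀ s := fun s => (hm s).coeFn_toLp
  refine ⟨L, fun s h0 => ?_, fun s => ?_⟩
  · refine eq_zero_of_trial_ae_eq_zero hκ hn (t₀ := t₀) ?_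
    have h1 := hL s
    rw [h0] at h1
    exact h1.symm.trans (Lp.coeFn_zero _ _ _)
  · refine hT.norm_sq_le_of_energy_le ha hσ1 hV hC hM (isFormFunction_trial hκ.ne' hn hσ s) (hL s)
      hl ?_
    rw [norm_sq_eq_integral (hL s)]
    exact trial_energy_le ha hV hκ.ne' hn hσ hVb M s

end

/-! ### Existence of the eigenvalues and the gap -/

section

variable {a : ℝ} {V : ℝ → ℝ} {σ : ℂ} {n : ℕ}

theorem conj_neg_one_pow_mul_self (n : ℕ) : conj ((-1 : ℂ) ^ n) * (-1) ^ n = 1 := by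
  rw [map_pow, map_neg, map_one, ← mul_pow]; norm_num

theorem exists_isEigenvalueSequence (ha : 0 < a) (hV : MemLp V ⊤ (cellMeasure a)) {p : ℕ}
    (hσ : σ = (-1) ^ p) : ∃ ν : ℕ → ℝ, IsEigenvalueSequence a V σ ν := by
  have hσ1 : conj σ * σ = 1 := by rw [hσ]; exact conj_neg_one_pow_mul_self p
  obtain ⟨C, hC0, hC⟩ := exists_potential_bound hV
  obtain ⟨T, hT⟩ := exists_isResolvent ha hσ1 hV hC0 hC le_rfl
  refine hT.exists_isEigenvalueSequence fun N => ?_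
  -- Trial spaces must have dimension of the parity of `p` to match σ; this one is positive and at
  -- least N.
  have hne : NeZero (2 * N + 2 + p) := ⟨by omega⟩
  have hκ : 0 < ((2 * N + 2 + p : ℕ) : ℝ) * Real.pi / a := by
    have := Real.pi_pos
    have : (0 : ℝ) < (2 * N + 2 + p : ℕ) := by exact_mod_cast Nat.pos_of_ne_zero hne.out
    positivity
  have hl : 0 < C + (((2 * N + 2 + p : ℕ) : ℝ) * Real.pi / a) ^ 2 - 0 / 2 + 0 + (C + 1) := by
    nlinarith [sq_nonneg (((2 * N + 2 + p : ℕ) : ℝ) * Real.pi / a)]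
  obtain ⟨L, hL, hLl⟩ := hT.exists_trial_space (t₀ := 0) ha hσ1 hV hC le_rfl hκ
    (div_mul_cancel₀ _ ha.ne') (by
      rw [hσ, pow_add, show 2 * N + 2 = 2 * (N + 1) by ring, pow_mul]; simp)
    (b := C) (c := 0) (ε := 0) (by
      filter_upwards [hC] with x hx
      simpa using (abs_le.1 hx).2) hl
  exact ⟨2 * N + 2 + p, hne, L, _, by omega, hl, hL, hLl⟩

/-- The gap between the eigenvalues of index `n` and `n + 1`, for a potential close to a single
harmonic. -/
theorem eigenvalue_gap (ha : 0 < a) (hV : MemLp V ⊤ (cellMeasure a)) [NeZero n]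
    (hσ : σ = (-1) ^ n) {κ t₀ b c ε : ℝ} (hκ : 0 < κ) (hn : κ * a = n * Real.pi) (hc0 : 0 ≤ c)
    (hc : c ≤ 12 * κ ^ 2) (hε : ε < c / 4)
    (hVb : ∀ᵐ x ∂(cellMeasure a), |V x - b - c * Real.cos (2 * (κ * x + t₀))| ≤ ε)
    {ν : ℕ → ℝ} (hν : IsEigenvalueSequence a V σ ν) : ν n < ν (n + 1) := by
  have hσ1 : conj σ * σ = 1 := by rw [hσ]; exact conj_neg_one_pow_mul_self n
  obtain ⟨C, hC0, hC⟩ := exists_potential_bound hV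
  -- The extra absolute value in the shift makes the threshold `hl` positive.
  have hM : C + 1 ≤ C + 1 + |b + κ ^ 2 - c / 2 + ε| := by linarith [abs_nonneg (b + κ ^ 2 - c / 2 + ε)]
  obtain ⟨T, hT⟩ := exists_isResolvent ha hσ1 hV hC0 hC hM
  have hl : 0 < b + κ ^ 2 - c / 2 + ε + (C + 1 + |b + κ ^ 2 - c / 2 + ε|) := by
    linarith [neg_abs_le (b + κ ^ 2 - c / 2 + ε)]
  obtain ⟨L, hL, hLl⟩ := hT.exists_trial_space (t₀ := t₀) (b := b) (c := c) (ε := ε) ha hσ1 hV hC hM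
    hκ hn hσ (by
      filter_upwards [hVb] with x hx
      linarith [(abs_le.1 hx).2]) hl
  have hfr : Module.finrank ℂ (ZMod n → ℂ) = n := by rw [Module.finrank_pi, ZMod.card]
  have hup := hT.eigenvalue_le hν L hL hl (by rw [hfr]; exact NeZero.one_le) hLl
  rw [hfr] at hup
  -- Shifting the phase by π/2 moves from the maxima of the harmonic to its minima and changes the
  -- sign of the cosine.
  obtain ⟨q, hq⟩ := exists_zeros (t₀ := t₀ + Real.pi / 2) hκ hn
  obtain ⟨u, v, w, hd, hu0, hpos, hen⟩ := hT.exists_vanishing ha hσ1 hV hν q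
  have hlow := hd.energy_ge ha hV hσ1 (t₀ := t₀ + Real.pi / 2) (b := b) (ε := ε) hκ hn hc0 hc (by
    filter_upwards [hVb] with x hx
    have e : 2 * (κ * x + (t₀ + Real.pi / 2)) = 2 * (κ * x + t₀) + Real.pi := by ring
    rw [e, Real.cos_add_pi]
    linarith [(abs_le.1 hx).1]) (fun x hx hs => by
      obtain ⟨i, rfl⟩ := hq x hx hs
      exact hu0 i)
  have := le_of_mul_le_mul_right (hlow.trans hen) hpos
  linarith

theorem sin_add_cos_eq (A B : ℝ) : ∃ φ : ℝ, ∀ y : ℝ,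
    A * Real.sin y + B * Real.cos y = √(A ^ 2 + B ^ 2) * Real.cos (y - φ) := by
  -- The phase is the argument of B + iA.
  refine ⟨(⟨B, A⟩ : ℂ).arg, fun y => ?_⟩
  have hn : ‖(⟨B, A⟩ : ℂ)‖ = √(A ^ 2 + B ^ 2) := by
    rw [Complex.norm_eq_sqrt_sq_add_sq, add_comm]
  have h1 := Complex.norm_mul_cos_arg (⟨B, A⟩ : ℂ)
  have h2 := Complex.norm_mul_sin_arg (⟨B, A⟩ : ℂ)
  rw [hn] at h1 h2
  simp only at h1 h2
  rw [Real.cos_sub]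
  linear_combination -Real.sin y * h2 - Real.cos y * h1

/-- The gap theorem in terms of the Fourier coefficients of the potential. -/
theorem eigenvalue_gap_of_fourier (ha : 0 < a) (hV : MemLp V ⊤ (cellMeasure a)) (hn : 1 ≤ n)
    (hσ : σ = (-1) ^ n) {A B b : ℝ}
    (hlt : √(A ^ 2 + B ^ 2) < 12 * Real.pi ^ 2 / a ^ 2 * (n : ℝ) ^ 2)
    (hclose : eLpNorm (fun x => V x - b - A * Real.sin (2 * Real.pi * n / a * x)
        - B * Real.cos (2 * Real.pi * n / a * x)) ⊤ (cellMeasure a)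
      < ENNReal.ofReal (1 / 4 * √(A ^ 2 + B ^ 2)))
    {ν : ℕ → ℝ} (hν : IsEigenvalueSequence a V σ ν) : ν n < ν (n + 1) := by
  have hne : NeZero n := ⟨by omega⟩
  have hπ := Real.pi_pos
  have hn0 : (0 : ℝ) < n := by exact_mod_cast hn
  obtain ⟨φ, hφ⟩ := sin_add_cos_eq A B
  set W : ℝ → ℝ := fun x => V x - b - A * Real.sin (2 * Real.pi * n / a * x)
        - B * Real.cos (2 * Real.pi * n / a * x) with hW
  have htop : eLpNorm W ⊤ (cellMeasure a) ≠ ⊤ := (hclose.trans ENNReal.ofReal_lt_top).ne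
  have hε : (eLpNorm W ⊤ (cellMeasure a)).toReal < √(A ^ 2 + B ^ 2) / 4 := by
    have := (ENNReal.lt_ofReal_iff_toReal_lt htop).1 hclose
    linarith
  refine eigenvalue_gap ha hV hσ (κ := n * Real.pi / a) (t₀ := -φ / 2) (b := b) (by positivity)
    (div_mul_cancel₀ _ ha.ne') (Real.sqrt_nonneg _) (hlt.le.trans (le_of_eq ?_)) hε ?_ hν
  · rw [div_pow, mul_pow]; ring
  · rw [eLpNorm_exponent_top] at htop ⊢
    filter_upwards [ae_le_eLpNormEssSup (f := W) (μ := cellMeasure a)] with x hx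
    have h1 := ENNReal.toReal_mono htop hx
    have e : V x - b - √(A ^ 2 + B ^ 2) * Real.cos (2 * (n * Real.pi / a * x + -φ / 2)) = W x := by
      have e1 : 2 * (n * Real.pi / a * x + -φ / 2) = 2 * Real.pi * n / a * x - φ := by ring
      rw [e1, ← hφ, hW]; ring
    rw [e]
    simpa using h1

end

end Hill

end

theorem theorem4p1 (a : ℝ) (ha : 0 < a) (V : ℝ → ℝ)
    (hV : MemLp V ⊤ (Hill.cellMeasure a)) (n : ℕ) (hn : 1 ≤ n)
    (hpos : 0 < √(Hill.sinCoeff a V n ^ 2 + Hill.cosCoeff a V n ^ 2))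
    (hlt : √(Hill.sinCoeff a V n ^ 2 + Hill.cosCoeff a V n ^ 2)
      < 12 * Real.pi ^ 2 / a ^ 2 * (n : ℝ) ^ 2)
    (hclose : eLpNorm (fun x => V x - Hill.cosCoeff a V 0
        - Hill.sinCoeff a V n * Real.sin (2 * Real.pi * n / a * x)
        - Hill.cosCoeff a V n * Real.cos (2 * Real.pi * n / a * x)) ⊤ (Hill.cellMeasure a)
      < ENNReal.ofReal (1 / 4 * √(Hill.sinCoeff a V n ^ 2 + Hill.cosCoeff a V n ^ 2))) :
    (∃ κ : ℕ → ℝ, Hill.IsEigenvalueSequence a V 1 κ) ∧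
    (∃ ν : ℕ → ℝ, Hill.IsEigenvalueSequence a V (-1) ν) ∧
    ∀ κ ν : ℕ → ℝ, Hill.IsEigenvalueSequence a V 1 κ → Hill.IsEigenvalueSequence a V (-1) ν →
      (Odd n → 0 < ν (n + 1) - ν n) ∧ (Even n → 0 < κ (n + 1) - κ n) := by
  refine ⟨Hill.exists_isEigenvalueSequence ha hV (p := 0) (by simp),
    Hill.exists_isEigenvalueSequence ha hV (p := 1) (by simp), fun κ ν hκ hν =>
    ⟨fun ho => sub_pos.2 ?_, fun he => sub_pos.2 ?_⟩⟩
  · exact Hill.eigenvalue_gap_of_fourier ha hV hn ho.neg_one_pow.symm hlt hclose hν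
  · exact Hill.eigenvalue_gap_of_fourier ha hV hn he.neg_one_pow.symm hlt hclose hκ
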